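/- Let $\Gamma$ be a countable discrete group, let $\Omega\subset\Gamma$ be a conjugacy-invariant subset, and let $\mathcal C_\Omega=\{C_\Gamma(t):t\in\Omega\}$ be the family of centralizers $C_\Gamma(t)=\{s\in\Gamma: st=ts\}$. Let $\Gamma\curvearrowright(X,\mu)$ be a non-singular action on a standard ($\sigma$-finite) measure space, and let $\Gamma$ act on functions by $(s\cdot f)(x)=f(s^{-1}x)$. For a family $\mathcal C$ of subgroups of $\Gamma$ put $K=\bigsqcup_{\Lambda\in\mathcal C}\Gamma/\Lambda$ with the translation action. A non-singular action $\Gamma\curvearrowright(Y,\nu)$ is called amenable relative to $\mathcal C$ if there is a positive linear map $\Phi\colon L^\infty(K\times Y)\to L^\infty(Y)$ with $\Phi(1\otimes f)=f$ for all $f\in L^\infty(Y)$ that is $\Gamma$-equivariant, where $\Gamma$ acts diagonally on $K\times Y$. Assume that there is no $\Gamma$-invariant measurable set $X_0\subset X$ with $\mu(X_0)>0$ such that $\Gamma\curvearrowright(X_0,\mu|_{X_0})$ is amenable relative to $\mathcal C_\Omega$. Let $\Gamma\ltimes L^\infty(X)$ be the crossed product von Neumann algebra, generated by $L^\infty(X)$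 and unitaries $\lambda(s)$, $s\in\Gamma$, with $\lambda(s)f\lambda(s)^*=s\cdot f$. Expand its elements as $w=\sum_{t\in\Gamma}\lambda(t)w^t$ with $w^t=E(\lambda(t)^*w)\in L^\infty(X)$, where $E$ is the canonical conditional expectation onto $L^\infty(X)$. Let $(w_n)_{n\in\mathbb N}$ be a norm-bounded sequence in $\Gamma\ltimes L^\infty(X)$ such that $w_n-\lambda(s)w_n\lambda(s)^*\to0$ ultrastrongly for every $s\in\Gamma$. Then, for every $n$, the sum $\sum_{t\in\Omega}|w_n^t|^2$ converges almost everywhere to an element of $L^\infty(X)$, and $$\sum_{t\in\Omega}|w_n^t|^2\to0\quad\text{ultrastrongly in }L^\infty(X)\text{ as }n\to\infty .$$ -/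

import Mathlib

open MeasureTheory Filter Topology
open scoped ENNReal ComplexOrder

noncomputable section

namespace CrossedProd

/-! ## Ultrastrong convergence and generated von Neumann algebras -/

section Operators

variable {H : Type*} [NormedAddCommGroup H] [InnerProductSpace ℂ H]

/-- Convergence of a sequence of bounded operators in the ultrastrong (σ-strong) topology:
`∑ₖ ‖(Tₙ - S) ξₖ‖² → 0` for every sequence of vectors with `∑ₖ ‖ξₖ‖² < ∞`. (The sum over `k`
is always convergent, since it is dominated by `‖Tₙ - S‖² ∑ₖ ‖ξₖ‖²`.) -/
def UltrastrongTendsto (T : ℕ → H →L[ℂ] H) (S : H →L[ℂ] H) : Prop :=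
  ∀ ξ : ℕ → H, Summable (fun k => ‖ξ k‖ ^ 2) →
    Tendsto (fun n => ∑' k, ‖(T n - S) (ξ k)‖ ^ 2) atTop (𝓝 0)

/-- The von Neumann algebra generated by a set `S` of bounded operators: the bicommutant of
`S ∪ S*`. -/
def generatedVN [CompleteSpace H] (S : Set (H →L[ℂ] H)) : VonNeumannAlgebra H where
  toStarSubalgebra :=
    StarSubalgebra.centralizer ℂ (StarSubalgebra.centralizer ℂ S : Set (H →L[ℂ] H))
  centralizer_centralizer' := by
    change Set.centralizer (Set.centralizer
      ((StarSubalgebra.centralizer ℂ (StarSubalgebra.centralizer ℂ S : Set (H →L[ℂ] H)) :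
        StarSubalgebra ℂ (H →L[ℂ] H)) : Set (H →L[ℂ] H))) = _
    rw [StarSubalgebra.coe_centralizer, Set.centralizer_centralizer_centralizer]
    exact (StarSubalgebra.coe_centralizer ℂ _).symm

theorem subset_generatedVN [CompleteSpace H] (S : Set (H →L[ℂ] H)) {T : H →L[ℂ] H}
    (hT : T ∈ S) : T ∈ generatedVN S := by
  change T ∈ StarSubalgebra.centralizer ℂ (StarSubalgebra.centralizer ℂ S : Set (H →L[ℂ] H))
  rw [StarSubalgebra.mem_centralizer_iff]
  intro g hg
  have hg' : g ∈ StarSubalgebra.centralizer ℂ S := hg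
  have hg'' := star_mem hg'
  rw [StarSubalgebra.mem_centralizer_iff] at hg' hg''
  exact ⟨(hg' T hT).1.symm, (hg'' T hT).1.symm⟩

theorem commute_generatedVN [CompleteSpace H] (S : Set (H →L[ℂ] H)) {T D : H →L[ℂ] H}
    (hT : T ∈ generatedVN S) (hD : ∀ g ∈ S, g * D = D * g)
    (hD' : ∀ g ∈ S, g * star D = star D * g) : D * T = T * D := by
  change T ∈ StarSubalgebra.centralizer ℂ (StarSubalgebra.centralizer ℂ S : Set (H →L[ℂ] H)) at hT
  rw [StarSubalgebra.mem_centralizer_iff] at hT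
  refine (hT D ?_).1
  change D ∈ StarSubalgebra.centralizer ℂ S
  rw [StarSubalgebra.mem_centralizer_iff]
  intro g hg
  refine ⟨hD g hg, ?_⟩
  have := congrArg star (hD' g hg)
  simpa using this.symm

end Operators

/-! ## Multiplication operators on `L²(X, μ)` -/

section MulOp

variable {X : Type*} [MeasurableSpace X] {μ : Measure X}

/-- The multiplication operator `ξ ↦ f ξ` on `L²(X, μ)`, for `f ∈ L^∞(X, μ)`. -/
def mulOp (f : Lp ℂ ∞ μ) : Lp ℂ 2 μ →L[ℂ] Lp ℂ 2 μ :=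
  (ContinuousLinearMap.mul ℂ ℂ).holderL μ ∞ 2 2 f

theorem coeFn_mulOp (f : Lp ℂ ∞ μ) (ξ : Lp ℂ 2 μ) : mulOp f ξ =ᵐ[μ] fun x => f x * ξ x :=
  (ContinuousLinearMap.mul ℂ ℂ).coeFn_holder f ξ

theorem norm_mulOp_apply_le (f : Lp ℂ ∞ μ) (ξ : Lp ℂ 2 μ) : ‖mulOp f ξ‖ ≤ ‖f‖ * ‖ξ‖ := by
  have h := (ContinuousLinearMap.mul ℂ ℂ).norm_holder_apply_apply_le (r := 2) f ξ
  refine h.trans ?_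
  have h1 : ‖ContinuousLinearMap.mul ℂ ℂ‖ ≤ 1 := ContinuousLinearMap.opNorm_mul_le ℂ ℂ
  calc _ ≤ 1 * ‖f‖ * ‖ξ‖ := by gcongr
    _ = _ := by rw [one_mul]

theorem inner_mulOp (f : Lp ℂ ∞ μ) (ξ η : Lp ℂ 2 μ) :
    inner ℂ (mulOp (star f) ξ) η = inner ℂ ξ (mulOp f η) := by
  rw [L2.inner_def, L2.inner_def]
  apply integral_congr_ae
  filter_upwards [coeFn_mulOp (star f) ξ, coeFn_mulOp f η, Lp.coeFn_star f] with x h1 h2 h3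
  rw [h1, h2, h3]
  simp [RCLike.inner_apply]
  ring

theorem mulOp_comm (f g : Lp ℂ ∞ μ) (ξ : Lp ℂ 2 μ) :
    mulOp f (mulOp g ξ) = mulOp g (mulOp f ξ) := by
  apply Lp.ext
  filter_upwards [coeFn_mulOp f (mulOp g ξ), coeFn_mulOp g (mulOp f ξ), coeFn_mulOp g ξ,
    coeFn_mulOp f ξ] with x h1 h2 h3 h4
  rw [h1, h2, h3, h4]
  ring

end MulOp

section MaxAbelian

variable {X : Type*} [MeasurableSpace X] {μ : Measure X}

theorem norm_sq_eq_integral (ξ : Lp ℂ 2 μ) : ‖ξ‖ ^ 2 = ∫ x, ‖ξ x‖ ^ 2 ∂μ := by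
  have h1 : (inner ℂ ξ ξ : ℂ) = (‖ξ‖ : ℂ) ^ 2 := inner_self_eq_norm_sq_to_K ξ
  rw [L2.inner_def] at h1
  have h2 : (∫ x, (inner ℂ (ξ x) (ξ x) : ℂ) ∂μ) = ((∫ x, ‖ξ x‖ ^ 2 ∂μ : ℝ) : ℂ) := by
    rw [← integral_complex_ofReal]
    apply integral_congr_ae
    filter_upwards with x
    rw [inner_self_eq_norm_sq_to_K]
    push_cast
    rfl
  rw [h2] at h1
  exact_mod_cast h1.symm

/-- For a σ-finite measure, `L^∞(X, μ)` is its own commutant in the bounded operators on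
`L²(X, μ)`. -/
theorem exists_eq_mulOp_of_commute [SigmaFinite μ] (T : Lp ℂ 2 μ →L[ℂ] Lp ℂ 2 μ)
    (hT : ∀ (f : Lp ℂ ∞ μ) (ξ : Lp ℂ 2 μ), T (mulOp f ξ) = mulOp f (T ξ)) :
    ∃ g : Lp ℂ ∞ μ, T = mulOp g := by
  obtain ⟨w, hw0, hwm, hwi⟩ := exists_pos_lintegral_lt_of_sigmaFinite μ (ε := 1) one_ne_zero
  set v : X → ℝ := fun x => Real.sqrt (w x) with hv
  have hv0 : ∀ x, 0 < v x := fun x => Real.sqrt_pos.2 (by exact_mod_cast hw0 x)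
  have hvm : Measurable v := (hwm.coe_nnreal_real).sqrt
  have hvL : MemLp (fun x => (v x : ℂ)) 2 μ := by
    rw [memLp_two_iff_integrable_sq_norm (by fun_prop)]
    have : (fun x => ‖(v x : ℂ)‖ ^ 2) = fun x => (w x : ℝ) := by
      funext x
      rw [Complex.norm_real, Real.norm_of_nonneg (hv0 x).le, hv]
      exact Real.sq_sqrt (by positivity)
    rw [this]
    refine ⟨hwm.coe_nnreal_real.aestronglyMeasurable, ?_⟩
    rw [hasFiniteIntegral_iff_enorm]
    refine lt_of_le_of_lt (le_of_eq ?_) (hwi.trans ENNReal.one_lt_top)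
    simp
  set V : Lp ℂ 2 μ := hvL.toLp _ with hV
  have hVx : V =ᵐ[μ] fun x => (v x : ℂ) := hvL.coeFn_toLp
  set U := T V with hU
  have hbound : ∀ᵐ x ∂μ, ‖U x‖ ≤ ‖T‖ * v x := by
    have hi : ∀ ξ : Lp ℂ 2 μ, Integrable (fun x => ‖ξ x‖ ^ 2) μ := fun ξ =>
      (memLp_two_iff_integrable_sq_norm (Lp.aestronglyMeasurable ξ)).1 (Lp.memLp ξ)
    have key : (fun x => ‖U x‖ ^ 2) ≤ᵐ[μ] fun x => ‖T‖ ^ 2 * ‖V x‖ ^ 2 := by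
      apply ae_le_of_forall_setIntegral_le (hi U) ((hi V).const_mul _)
      intro A hA _
      have hAm : MemLp (A.indicator (fun _ => (1 : ℂ))) ∞ μ := by
        refine memLp_top_of_bound ((measurable_const.indicator hA).aestronglyMeasurable) 1 ?_
        filter_upwards with x
        by_cases hx : x ∈ A <;> simp [hx]
      have hind : ∀ ξ : Lp ℂ 2 μ, ‖mulOp (hAm.toLp _) ξ‖ ^ 2 = ∫ x in A, ‖ξ x‖ ^ 2 ∂μ := by
        intro ξ
        rw [norm_sq_eq_integral, ← integral_indicator hA]
        apply integral_congr_ae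
        filter_upwards [coeFn_mulOp (hAm.toLp _) ξ, hAm.coeFn_toLp] with x h1 h2
        rw [h1, h2]
        by_cases hx : x ∈ A <;> simp [hx]
      rw [integral_const_mul, ← hind, ← hind, ← mul_pow, hU, ← hT]
      gcongr
      exact T.le_opNorm _
    filter_upwards [key, hVx] with x h1 h2
    rw [h2, Complex.norm_real, Real.norm_of_nonneg (hv0 x).le, ← mul_pow] at h1
    exact le_of_sq_le_sq h1 (mul_nonneg (norm_nonneg _) (hv0 x).le)
  have hgm : AEStronglyMeasurable (fun x => U x / (v x : ℂ)) μ := by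
    have := (Lp.aestronglyMeasurable U).aemeasurable
    exact (this.div (by fun_prop)).aestronglyMeasurable
  have hg : MemLp (fun x => U x / (v x : ℂ)) ∞ μ := by
    refine memLp_top_of_bound hgm ‖T‖ ?_
    filter_upwards [hbound] with x hx
    rw [norm_div, Complex.norm_real, Real.norm_of_nonneg (hv0 x).le]
    exact (div_le_iff₀ (hv0 x)).2 hx
  refine ⟨hg.toLp _, ?_⟩
  ext1 ξ
  have hξm := (Lp.aestronglyMeasurable ξ).aemeasurable
  have hpos : ∀ x, 0 < v x + ‖ξ x‖ := fun x => add_pos_of_pos_of_nonneg (hv0 x) (norm_nonneg _)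
  have hf : MemLp (fun x => ((v x / (v x + ‖ξ x‖) : ℝ) : ℂ)) ∞ μ := by
    refine memLp_top_of_bound (AEMeasurable.aestronglyMeasurable (by fun_prop)) 1 ?_
    filter_upwards with x
    rw [Complex.norm_real, Real.norm_of_nonneg (div_nonneg (hv0 x).le (hpos x).le)]
    exact (div_le_one (hpos x)).2 (by linarith [norm_nonneg (ξ x)])
  have hf' : MemLp (fun x => ξ x / ((v x + ‖ξ x‖ : ℝ) : ℂ)) ∞ μ := by
    refine memLp_top_of_bound (AEMeasurable.aestronglyMeasurable (by fun_prop)) 1 ?_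
    filter_upwards with x
    rw [norm_div, Complex.norm_real, Real.norm_of_nonneg (hpos x).le]
    exact (div_le_one (hpos x)).2 (by linarith [hv0 x])
  have heq : mulOp (hf.toLp _) ξ = mulOp (hf'.toLp _) V := by
    apply Lp.ext
    filter_upwards [coeFn_mulOp (hf.toLp _) ξ, coeFn_mulOp (hf'.toLp _) V, hf.coeFn_toLp,
      hf'.coeFn_toLp, hVx] with x h1 h2 h3 h4 h5
    rw [h1, h2, h3, h4, h5]
    push_cast
    ring
  have h := congrArg T heq
  rw [hT, hT] at h
  apply Lp.ext
  filter_upwards [coeFn_mulOp (hf.toLp _) (T ξ), coeFn_mulOp (hf'.toLp _) U, hf.coeFn_toLp,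
    hf'.coeFn_toLp, coeFn_mulOp (hg.toLp _) ξ, hg.coeFn_toLp] with x h1 h2 h3 h4 h5 h6
  rw [h, h2, h4, h3] at h1
  rw [h5, h6]
  have hp : ((v x + ‖ξ x‖ : ℝ) : ℂ) ≠ 0 := by exact_mod_cast (hpos x).ne'
  have hvx : (v x : ℂ) ≠ 0 := by exact_mod_cast (hv0 x).ne'
  rw [Complex.ofReal_div] at h1
  field_simp at h1 ⊢
  linear_combination -h1

end MaxAbelian

/-! ## Non-singular actions -/

section Action

theorem ae_norm_le_norm {X : Type*} [MeasurableSpace X] {μ : Measure X} (f : Lp ℂ ∞ μ) :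
    ∀ᵐ x ∂μ, ‖f x‖ ≤ ‖f‖ := by
  filter_upwards [ae_le_eLpNormEssSup (f := f) (μ := μ)] with x hx
  rw [Lp.norm_def, eLpNorm_exponent_top, ← toReal_enorm]
  refine ENNReal.toReal_mono ?_ hx
  rw [← eLpNorm_exponent_top]
  exact Lp.eLpNorm_ne_top f

/-- The action of the group `Γ` on the measure space `(X, μ)` is non-singular: every group element
acts by a measurable map that preserves the class of `μ`. (Null sets have null preimages under
`s` and under `s⁻¹`, so that `μ` and its translates are equivalent.) -/
class NonsingularAction (Γ : Type*) {X : Type*} [Group Γ] [MeasurableSpace X] [MulAction Γ X]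
    (μ : Measure X) : Prop where
  quasiMeasurePreserving : ∀ s : Γ, Measure.QuasiMeasurePreserving (fun x : X => s • x) μ μ

variable {Γ : Type*} [Group Γ] {X : Type*} [MeasurableSpace X] [MulAction Γ X]

/-- The restriction of a non-singular action to an invariant measurable subset `E` is
non-singular; the measure space `(E, μ|_E)` is represented by `(X, μ.restrict E)`. -/
theorem NonsingularAction.restrict (μ : Measure X) [NonsingularAction Γ μ] {E : Set X}
    (hE : ∀ (s : Γ) (x : X), s • x ∈ E ↔ x ∈ E) : NonsingularAction Γ (μ.restrict E) where
  quasiMeasurePreserving s := by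
    have h := NonsingularAction.quasiMeasurePreserving (μ := μ) s
    refine ⟨h.measurable, ?_⟩
    refine Measure.AbsolutelyContinuous.mk fun A hA h0 => ?_
    rw [Measure.map_apply h.measurable hA, Measure.restrict_apply (h.measurable hA)]
    rw [Measure.restrict_apply hA] at h0
    have : (fun x : X => s • x) ⁻¹' A ∩ E = (fun x : X => s • x) ⁻¹' (A ∩ E) := by
      ext x
      simp [hE]
    rw [this]
    exact h.preimage_null h0

variable (μ : Measure X) [NonsingularAction Γ μ]

theorem memLp_translate (s : Γ) (f : Lp ℂ ∞ μ) : MemLp (fun x => f (s⁻¹ • x)) ∞ μ := by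
  have h := NonsingularAction.quasiMeasurePreserving (μ := μ) s⁻¹
  refine memLp_top_of_bound ((Lp.aestronglyMeasurable f).comp_quasiMeasurePreserving h) ‖f‖ ?_
  exact h.ae (ae_norm_le_norm f)

variable {μ}

/-- The action of `Γ` on `L^∞(X, μ)`: `(s · f)(x) = f(s⁻¹ x)`. -/
def translate (s : Γ) (f : Lp ℂ ∞ μ) : Lp ℂ ∞ μ := (memLp_translate μ s f).toLp _

theorem coeFn_translate (s : Γ) (f : Lp ℂ ∞ μ) :
    translate s f =ᵐ[μ] fun x => f (s⁻¹ • x) := (memLp_translate μ s f).coeFn_toLp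

theorem norm_translate_le (s : Γ) (f : Lp ℂ ∞ μ) : ‖translate s f‖ ≤ ‖f‖ := by
  have h := NonsingularAction.quasiMeasurePreserving (μ := μ) s⁻¹
  refine ENNReal.toReal_le_of_le_ofReal (norm_nonneg f) ?_
  rw [eLpNorm_exponent_top]
  refine eLpNormEssSup_le_of_ae_bound ?_
  filter_upwards [coeFn_translate s f, h.ae (ae_norm_le_norm f)] with x h1 h2
  rw [h1]
  exact h2

end Action

/-! ## Relative amenability -/

section Amenable

variable {Γ : Type*} [Group Γ] {X : Type*} [MeasurableSpace X] [MulAction Γ X]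
  {μ : Measure X} [NonsingularAction Γ μ] {K : Type*} [MulAction Γ K]

/-- `L^∞(K × X)` for a discrete set `K`: bounded families `(F(k, ·))_{k ∈ K}` in `L^∞(X, μ)`. -/
abbrev LInftyProd (K : Type*) (μ : Measure X) : Type _ := lp (fun _ : K => Lp ℂ ∞ μ) ∞

/-- The diagonal action of `Γ` on `L^∞(K × X)`: `(s · F)(k, x) = F(s⁻¹ k, s⁻¹ x)`. -/
def diagTranslate (s : Γ) (F : LInftyProd K μ) : LInftyProd K μ :=
  ⟨fun k => translate s (F (s⁻¹ • k)), memℓp_infty ⟨‖F‖, by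
    rintro _ ⟨k, rfl⟩
    exact (norm_translate_le s _).trans (lp.norm_apply_le_norm ENNReal.top_ne_zero F _)⟩⟩

/-- The function `1 ⊗ f` on `K × X`, i.e. `(1 ⊗ f)(k, x) = f(x)`. -/
def oneTensor (K : Type*) (f : Lp ℂ ∞ μ) : LInftyProd K μ :=
  ⟨fun _ => f, memℓp_infty ⟨‖f‖, by rintro _ ⟨k, rfl⟩; exact le_rfl⟩⟩

/-- A `Γ`-equivariant conditional expectation `Φ` from `L^∞(K × X)` onto `L^∞(X)`: a positive
linear map that satisfies `Φ(1 ⊗ f) = f` for all `f` and intertwines the actions of `Γ`.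
(`0 ≤ z` for a complex number `z` means that `z` is real and non-negative.) -/
structure IsEquivariantCondExp (Γ : Type*) [Group Γ] {X : Type*} [MeasurableSpace X]
    [MulAction Γ X] {μ : Measure X} [NonsingularAction Γ μ] {K : Type*} [MulAction Γ K]
    (Φ : LInftyProd K μ →ₗ[ℂ] Lp ℂ ∞ μ) : Prop where
  nonneg : ∀ F : LInftyProd K μ, (∀ k, ∀ᵐ x ∂μ, 0 ≤ F k x) → ∀ᵐ x ∂μ, 0 ≤ Φ F x
  map_oneTensor : ∀ f : Lp ℂ ∞ μ, Φ (oneTensor K f) = f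
  equivariant : ∀ (s : Γ) (F : LInftyProd K μ), Φ (diagTranslate s F) = translate s (Φ F)

/-- The `Γ`-set `K = ⊔_{Λ ∈ 𝒞} Γ/Λ` (disjoint union), with `Γ` acting by translation. -/
def CosetUnion (𝒞 : Set (Subgroup Γ)) : Type _ := Σ Λ : 𝒞, Γ ⧸ (Λ : Subgroup Γ)

instance instMulActionCosetUnion (𝒞 : Set (Subgroup Γ)) : MulAction Γ (CosetUnion 𝒞) where
  smul s k := ⟨k.1, s • k.2⟩
  one_smul k := Sigma.ext rfl (heq_of_eq (one_smul Γ k.2))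
  mul_smul s t k := Sigma.ext rfl (heq_of_eq (mul_smul s t k.2))

/-- The non-singular action of `Γ` on `(X, μ)` is amenable relative to the family `𝒞` of
subgroups of `Γ`. -/
def IsAmenableRelativeTo (𝒞 : Set (Subgroup Γ)) (μ : Measure X) [NonsingularAction Γ μ] : Prop :=
  ∃ Φ : LInftyProd (CosetUnion 𝒞) μ →ₗ[ℂ] Lp ℂ ∞ μ, IsEquivariantCondExp Γ Φ

/-- The action of `Γ` on `(X, μ)` has a non-null component that is amenable relative to `𝒞`:
there is a `Γ`-invariant measurable set `E` of positive measure such that the restricted action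
of `Γ` on `(E, μ|_E)` is amenable relative to `𝒞`. -/
def HasAmenableComponent (𝒞 : Set (Subgroup Γ)) (μ : Measure X) [NonsingularAction Γ μ] : Prop :=
  ∃ (E : Set X) (hE : ∀ (s : Γ) (x : X), s • x ∈ E ↔ x ∈ E), MeasurableSet E ∧ μ E ≠ 0 ∧
    haveI : NonsingularAction Γ (μ.restrict E) := NonsingularAction.restrict μ hE
    IsAmenableRelativeTo 𝒞 (μ.restrict E)

end Amenable

/-! ## The crossed product -/

section Crossed

variable {Γ : Type*} {X : Type*} [MeasurableSpace X] {μ : Measure X}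

/-- The Hilbert space `ℓ²(Γ) ⊗ L²(X, μ) = ℓ²(Γ, L²(X, μ))`, on which the crossed product acts. -/
abbrev RegHilbert (Γ : Type*) (μ : Measure X) : Type _ := lp (fun _ : Γ => Lp ℂ 2 μ) 2

theorem two_toReal_pos : 0 < (2 : ℝ≥0∞).toReal := by norm_num

theorem summable_regHilbert (ξ : RegHilbert Γ μ) :
    Summable fun t => ‖ξ t‖ ^ (2 : ℝ≥0∞).toReal :=
  (lp.memℓp ξ).summable two_toReal_pos

/-- The operator `(ξ_t)_t ↦ (A_t ξ_t)_t` on `ℓ²(Γ, L²(X, μ))`, for a bounded family of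
operators `A_t`. -/
def diagOp (A : Γ → Lp ℂ 2 μ →L[ℂ] Lp ℂ 2 μ) (C : ℝ) (hC : 0 ≤ C)
    (hA : ∀ t ξ, ‖A t ξ‖ ≤ C * ‖ξ‖) : RegHilbert Γ μ →L[ℂ] RegHilbert Γ μ :=
  LinearMap.mkContinuous
    { toFun := fun ξ => ⟨fun t => A t (ξ t), by
        refine Memℓp.mono' ((lp.memℓp ξ).const_smul (C : ℂ)) fun t => ?_
        refine (hA t (ξ t)).trans ?_
        rw [Pi.smul_apply, norm_smul, Complex.norm_real, Real.norm_of_nonneg hC]⟩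
      map_add' := fun ξ η => by ext1; funext t; exact map_add (A t) _ _
      map_smul' := fun c ξ => by ext1; funext t; exact map_smul (A t) c _ }
    C fun ξ => by
      refine (lp.norm_mono (y := (C : ℂ) • ξ) two_ne_zero fun t => ?_).trans ?_
      · refine (hA t (ξ t)).trans ?_
        rw [lp.coeFn_smul, Pi.smul_apply, norm_smul, Complex.norm_real, Real.norm_of_nonneg hC]
      · rw [norm_smul, Complex.norm_real, Real.norm_of_nonneg hC]

theorem diagOp_apply (A : Γ → Lp ℂ 2 μ →L[ℂ] Lp ℂ 2 μ) (C : ℝ) (hC : 0 ≤ C)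
    (hA : ∀ t ξ, ‖A t ξ‖ ≤ C * ‖ξ‖) (ξ : RegHilbert Γ μ) (t : Γ) :
    diagOp A C hC hA ξ t = A t (ξ t) := rfl

theorem diagConst_adjoint (g : Lp ℂ ∞ μ) :
    star (diagOp (fun _ : Γ => mulOp g) ‖g‖ (norm_nonneg g) fun _ => norm_mulOp_apply_le g) =
      diagOp (fun _ : Γ => mulOp (star g)) ‖star g‖ (norm_nonneg _)
        fun _ => norm_mulOp_apply_le (star g) := by
  rw [ContinuousLinearMap.star_eq_adjoint]
  symm
  rw [ContinuousLinearMap.eq_adjoint_iff]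
  intro ξ η
  rw [lp.inner_eq_tsum, lp.inner_eq_tsum]
  exact tsum_congr fun t => inner_mulOp g (ξ t) (η t)

variable [Group Γ]

/-- The unitary `λ(s)` on `ℓ²(Γ, L²(X, μ))`: `(λ(s) ξ)(t) = ξ(s⁻¹ t)`. -/
def leftReg (μ : Measure X) (s : Γ) : RegHilbert Γ μ →L[ℂ] RegHilbert Γ μ :=
  LinearMap.mkContinuous
    { toFun := fun ξ => ⟨fun t => ξ (s⁻¹ * t),
        memℓp_gen ((Equiv.mulLeft s⁻¹).summable_iff.2 (summable_regHilbert ξ))⟩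
      map_add' := fun ξ η => rfl
      map_smul' := fun c ξ => rfl }
    1 fun ξ => by
      rw [one_mul]
      refine lp.norm_le_of_tsum_le two_toReal_pos (norm_nonneg ξ) ?_
      rw [lp.norm_rpow_eq_tsum two_toReal_pos ξ]
      exact ((Equiv.mulLeft s⁻¹).tsum_eq fun t => ‖ξ t‖ ^ (2 : ℝ≥0∞).toReal).le

theorem leftReg_apply (s : Γ) (ξ : RegHilbert Γ μ) (t : Γ) : leftReg μ s ξ t = ξ (s⁻¹ * t) := rfl

/-- The isometry `L²(X, μ) → ℓ²(Γ, L²(X, μ))`, `ξ ↦ δ_e ⊗ ξ`. -/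
def embedOne (Γ : Type*) [Group Γ] (μ : Measure X) : Lp ℂ 2 μ →L[ℂ] RegHilbert Γ μ :=
  haveI := Classical.decEq Γ
  lp.singleContinuousLinearMap ℂ (fun _ : Γ => Lp ℂ 2 μ) 2 1

/-- The compression `V* T V` of an operator `T` on `ℓ²(Γ, L²(X, μ))` along `V ξ = δ_e ⊗ ξ`. On the
crossed product this is the canonical conditional expectation onto `L^∞(X, μ)`, which maps
`∑ₜ λ(t) fₜ` to `f_e`. -/
def compress (T : RegHilbert Γ μ →L[ℂ] RegHilbert Γ μ) : Lp ℂ 2 μ →L[ℂ] Lp ℂ 2 μ :=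
  ContinuousLinearMap.adjoint (embedOne Γ μ) ∘L T ∘L embedOne Γ μ

theorem embedOne_apply_one (ξ : Lp ℂ 2 μ) : embedOne Γ μ ξ 1 = ξ := by
  classical
  exact Pi.single_eq_same _ _

theorem embedOne_apply_ne (ξ : Lp ℂ 2 μ) {t : Γ} (ht : t ≠ 1) : embedOne Γ μ ξ t = 0 := by
  classical
  exact Pi.single_eq_of_ne ht _

theorem compress_apply (T : RegHilbert Γ μ →L[ℂ] RegHilbert Γ μ) (ξ : Lp ℂ 2 μ) :
    compress T ξ = T (embedOne Γ μ ξ) 1 := by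
  classical
  refine ext_inner_left ℂ fun η => ?_
  rw [compress, ContinuousLinearMap.comp_apply, ContinuousLinearMap.adjoint_inner_right]
  exact lp.inner_single_left (G := fun _ : Γ => Lp ℂ 2 μ) 1 η _

variable [MulAction Γ X] [NonsingularAction Γ μ]

/-- The canonical copy of `f ∈ L^∞(X, μ)` in the crossed product, acting on `ℓ²(Γ, L²(X, μ))` by
`(f ξ)(t) = (t⁻¹ · f) ξ(t)`, i.e. `(f ξ)(t, x) = f(t x) ξ(t, x)`. One has
`λ(s) f λ(s)* = s · f`. -/
def embedLInfty (Γ : Type*) [Group Γ] [MulAction Γ X] [NonsingularAction Γ μ] (f : Lp ℂ ∞ μ) :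
    RegHilbert Γ μ →L[ℂ] RegHilbert Γ μ :=
  diagOp (fun t : Γ => mulOp (translate t⁻¹ f)) ‖f‖ (norm_nonneg f) fun t ξ =>
    (norm_mulOp_apply_le _ ξ).trans (by gcongr; exact norm_translate_le t⁻¹ f)

/-- The crossed product `Γ ⋉ L^∞(X, μ)`: the von Neumann algebra on `ℓ²(Γ, L²(X, μ))` generated
by `{λ(s) : s ∈ Γ}` and `L^∞(X, μ)`. -/
def crossedProduct (Γ : Type*) [Group Γ] [MulAction Γ X] (μ : Measure X)
    [NonsingularAction Γ μ] : VonNeumannAlgebra (RegHilbert Γ μ) :=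
  generatedVN (Set.range (leftReg (Γ := Γ) μ) ∪ Set.range (embedLInfty (μ := μ) Γ))

/-- The unitary `λ(s)` as an element of the crossed product. -/
theorem leftReg_mem (s : Γ) : leftReg μ s ∈ crossedProduct Γ μ :=
  subset_generatedVN _ (Or.inl ⟨s, rfl⟩)

theorem gen_commute (g : Lp ℂ ∞ μ) (T : RegHilbert Γ μ →L[ℂ] RegHilbert Γ μ)
    (hT : T ∈ Set.range (leftReg (Γ := Γ) μ) ∪ Set.range (embedLInfty (μ := μ) Γ)) :
    T * diagOp (fun _ : Γ => mulOp g) ‖g‖ (norm_nonneg g) (fun _ => norm_mulOp_apply_le g) =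
      diagOp (fun _ : Γ => mulOp g) ‖g‖ (norm_nonneg g) (fun _ => norm_mulOp_apply_le g) * T := by
  rcases hT with ⟨s, rfl⟩ | ⟨f, rfl⟩
  · refine ContinuousLinearMap.ext fun ξ => lp.ext (funext fun t => ?_)
    rw [mul_apply_eq_comp, mul_apply_eq_comp, leftReg_apply,
      diagOp_apply, diagOp_apply, leftReg_apply]
  · refine ContinuousLinearMap.ext fun ξ => lp.ext (funext fun t => ?_)
    rw [mul_apply_eq_comp, mul_apply_eq_comp, embedLInfty,
      diagOp_apply, diagOp_apply, diagOp_apply, diagOp_apply]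
    exact mulOp_comm _ _ _

/-- The canonical conditional expectation maps the crossed product into `L^∞(X, μ)`. -/
theorem exists_compress_eq_mulOp [SigmaFinite μ] {T : RegHilbert Γ μ →L[ℂ] RegHilbert Γ μ}
    (hT : T ∈ crossedProduct Γ μ) : ∃ f : Lp ℂ ∞ μ, compress T = mulOp f := by
  refine exists_eq_mulOp_of_commute _ fun g ξ => ?_
  have h := commute_generatedVN _ hT (gen_commute (Γ := Γ) g)
    (by rw [diagConst_adjoint]; exact gen_commute (Γ := Γ) (star g))
  have h1 : embedOne Γ μ (mulOp g ξ) =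
      diagOp (fun _ : Γ => mulOp g) ‖g‖ (norm_nonneg g) (fun _ => norm_mulOp_apply_le g)
        (embedOne Γ μ ξ) := by
    apply lp.ext
    funext t
    rw [diagOp_apply]
    by_cases ht : t = 1
    · subst ht
      rw [embedOne_apply_one, embedOne_apply_one]
    · rw [embedOne_apply_ne _ ht, embedOne_apply_ne _ ht, map_zero]
  rw [compress_apply, compress_apply, h1, ← mul_apply_eq_comp, ← h]
  rfl

/-- The coefficient `w^t ∈ L^∞(X, μ)` in the expansion `w = ∑ₜ λ(t) w^t` of an element `w` of the
crossed product: `w^t` is the image of `λ(t)* w` under the canonical conditional expectation onto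
`L^∞(X, μ)`. Equivalently `w (δ_e ⊗ ξ) = ∑ₜ δ_t ⊗ w^t ξ` for all `ξ ∈ L²(X, μ)`. -/
def coeff [SigmaFinite μ] (w : crossedProduct Γ μ) (t : Γ) : Lp ℂ ∞ μ :=
  (exists_compress_eq_mulOp (mul_mem (star_mem (leftReg_mem (μ := μ) t)) w.2)).choose

theorem mulOp_coeff [SigmaFinite μ] (w : crossedProduct Γ μ) (t : Γ) :
    compress (star (leftReg μ t) * (w : RegHilbert Γ μ →L[ℂ] RegHilbert Γ μ)) =
      mulOp (coeff w t) :=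
  (exists_compress_eq_mulOp (mul_mem (star_mem (leftReg_mem (μ := μ) t)) w.2)).choose_spec

end Crossed

end CrossedProd

end

open CrossedProd

/-!
Suppose that the functions `h_n = ∑_{t ∈ Ω} |w_nᵗ|²` do not tend to zero. The idea is to view
`|w_nᵗ(x)|²`, `t ∈ Ω`, as a density on `Ω × X` and to pass to the limit.

For a conjugacy-invariant set `Ω` there is a `Γ`-map `π` from `Ω`, with the conjugation action, to
the disjoint union `K` of the coset spaces of the centralizers
(`exists_equivariant_map_cosetUnion`). For `F ∈ L^∞(K × X)` put
`Ψ_n(F) = ∑_{t ∈ Ω} F(π t, ·) |w_nᵗ|²`. As an operator on `L²(X)` this is `V* w_n* D_F w_n V`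
(`density`), where `V ξ = δ_e ⊗ ξ` and `D_F` is multiplication by the pullback of `F`; in this form
no question of convergence of the sum arises. Along an ultrafilter `𝒰` the operators `Ψ_n(F)` have
a weak limit, which commutes with `L^∞(X)` and hence is multiplication by a function `Ψ(F)`
(`exists_isLimitMap`). The map `Ψ` is positive and satisfies `Ψ(1 ⊗ f) = h f` with `h = Ψ(1)`.

The map `Ψ` is equivariant (`IsLimitMap.equivariant`). Indeed, the crossed product commutes with the
operators `(R_s ξ)(t) = U_s ξ(t s)`, where `U_s` is the Koopman isometry of `L²(X)`. Therefore
`w_n λ(s)* V U_s = R_s w_n V`, and asymptotic centrality shows that `w_n V U_s ξ` and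
`λ(s) R_s w_n V ξ` are asymptotically equal; the isometry `λ(s) R_s` intertwines `D_F` and
`D_{s · F}`.

If `h ≠ 0`, then `h > ε` on some non-null invariant set, on which `h⁻¹ Ψ` is an equivariant
conditional expectation, so that the action has an amenable component
(`hasAmenableComponent_of_positive_map`). Hence `h = 0` for every ultrafilter `𝒰`, which means that
`h_n → 0` weakly. As `h_n = A*A` with `A = P_Ω w_n V`, one has `‖h_n ξ‖² ≤ C² ⟨ξ, h_n ξ⟩`, and
dominated convergence gives ultrastrong convergence.

That `h_n` is the pointwise sum of the functions `|w_nᵗ|²` follows by comparing integrals over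
measurable sets (`ae_hasSum_norm_coeff_sq`).
-/

namespace CrossedProd

/-! ### Weak operator limits along ultrafilters -/

section WeakLimit

variable {H : Type*} [NormedAddCommGroup H] [InnerProductSpace ℂ H] [CompleteSpace H]

/-- A bounded family of operators converges along every ultrafilter in the weak operator
topology. -/
theorem exists_weak_limit {ι : Type*} (𝒰 : Ultrafilter ι) (A : ι → H →L[ℂ] H) {C : ℝ}
    (hA : ∀ i, ‖A i‖ ≤ C) :
    ∃ T : H →L[ℂ] H, ∀ ξ η : H,
      Tendsto (fun i => inner ℂ ξ (A i η)) 𝒰 (𝓝 (inner ℂ ξ (T η))) := by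
  have hb : ∀ ξ η : H, ∀ i, ‖(inner ℂ (A i ξ) η : ℂ)‖ ≤ C * ‖ξ‖ * ‖η‖ := fun ξ η i =>
    (norm_inner_le_norm _ _).trans
      (mul_le_mul_of_nonneg_right ((A i).le_of_opNorm_le (hA i) ξ) (norm_nonneg _))
  have hex : ∀ ξ η : H, ∃ z : ℂ, ‖z‖ ≤ C * ‖ξ‖ * ‖η‖ ∧
      Tendsto (fun i => (inner ℂ (A i ξ) η : ℂ)) 𝒰 (𝓝 z) := by
    intro ξ η
    obtain ⟨z, hz, hlim⟩ := (isCompact_closedBall (0 : ℂ) (C * ‖ξ‖ * ‖η‖)).ultrafilter_le_nhds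
      (𝒰.map fun i => (inner ℂ (A i ξ) η : ℂ))
      (le_principal_iff.2 (Filter.mem_map.2 (Eventually.of_forall fun i => by simpa using hb ξ η i)))
    exact ⟨z, by simpa using hz, hlim⟩
  choose B hBn hB using hex
  let B₀ : H →ₗ⋆[ℂ] H →ₗ[ℂ] ℂ := LinearMap.mk₂'ₛₗ (starRingEnd ℂ) (RingHom.id ℂ) B
    (fun ξ₁ ξ₂ η => tendsto_nhds_unique (hB _ _) (by
      simpa only [map_add, inner_add_left] using (hB ξ₁ η).add (hB ξ₂ η)))
    (fun c ξ η => tendsto_nhds_unique (hB _ _) (by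
      simpa only [map_smul, inner_smul_left, smul_eq_mul] using
        (hB ξ η).const_mul ((starRingEnd ℂ) c)))
    (fun ξ η₁ η₂ => tendsto_nhds_unique (hB _ _) (by
      simpa only [inner_add_right] using (hB ξ η₁).add (hB ξ η₂)))
    (fun c ξ η => tendsto_nhds_unique (hB _ _) (by
      simpa only [inner_smul_right, smul_eq_mul, RingHom.id_apply] using
        (hB ξ η).const_mul c))
  let T := InnerProductSpace.continuousLinearMapOfBilin (B₀.mkContinuous₂ C fun ξ η => hBn ξ η)
  have hT : ∀ ξ η, (inner ℂ (T ξ) η : ℂ) = B ξ η := fun ξ η =>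
    InnerProductSpace.continuousLinearMapOfBilin_apply _ ξ η
  refine ⟨T, fun ξ η => ?_⟩
  have h := (hB η ξ).star
  rw [← hT] at h
  simpa only [RCLike.star_def, inner_conj_symm] using h

end WeakLimit

/-! ### Multiplication operators and positivity -/

section MulOp

variable {X : Type*} [MeasurableSpace X] {μ : Measure X}

/-- A `σ`-finite measure admits a strictly positive square integrable function. -/
theorem exists_pos_memLp_two (μ : Measure X) [SigmaFinite μ] :
    ∃ v : X → ℝ, (∀ x, 0 < v x) ∧ Measurable v ∧ MemLp (fun x => (v x : ℂ)) 2 μ := by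
  obtain ⟨w, hw0, hwm, hwi⟩ := exists_pos_lintegral_lt_of_sigmaFinite μ (ε := 1) one_ne_zero
  have hw0' : ∀ x, 0 < Real.sqrt (w x) := fun x => Real.sqrt_pos.2 (by exact_mod_cast hw0 x)
  have hm : Measurable fun x => Real.sqrt (w x) := (hwm.coe_nnreal_real).sqrt
  refine ⟨fun x => Real.sqrt (w x), hw0', hm, ?_⟩
  rw [memLp_two_iff_integrable_sq_norm (by fun_prop)]
  have : (fun x => ‖((Real.sqrt (w x) : ℝ) : ℂ)‖ ^ 2) = fun x => (w x : ℝ) := by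
    funext x
    rw [Complex.norm_real, Real.norm_of_nonneg (hw0' x).le]
    exact Real.sq_sqrt (by positivity)
  rw [this]
  refine ⟨hwm.coe_nnreal_real.aestronglyMeasurable, ?_⟩
  rw [hasFiniteIntegral_iff_enorm]
  refine lt_of_le_of_lt (le_of_eq ?_) (hwi.trans ENNReal.one_lt_top)
  simp

theorem mulOp_injective [SigmaFinite μ] : Function.Injective (mulOp (μ := μ)) := by
  intro f g hfg
  obtain ⟨v, hv0, -, hv⟩ := exists_pos_memLp_two μ
  apply Lp.ext
  have h := congrArg (fun T => T (hv.toLp _)) hfg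
  filter_upwards [coeFn_mulOp f (hv.toLp _), coeFn_mulOp g (hv.toLp _), hv.coeFn_toLp]
    with x h1 h2 h3
  change mulOp f _ = mulOp g _ at h
  rw [h, h2, h3] at h1
  have : (v x : ℂ) ≠ 0 := by exact_mod_cast (hv0 x).ne'
  exact (mul_right_cancel₀ this h1).symm

theorem mulOp_add (f g : Lp ℂ ∞ μ) : mulOp (f + g) = mulOp f + mulOp g :=
  map_add ((ContinuousLinearMap.mul ℂ ℂ).holderL μ ∞ 2 2) f g

theorem mulOp_smul (c : ℂ) (f : Lp ℂ ∞ μ) : mulOp (c • f) = c • mulOp f :=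
  map_smul ((ContinuousLinearMap.mul ℂ ℂ).holderL μ ∞ 2 2) c f

theorem mulOp_zero : mulOp (0 : Lp ℂ ∞ μ) = 0 :=
  map_zero ((ContinuousLinearMap.mul ℂ ℂ).holderL μ ∞ 2 2)

theorem inner_mulOp_nonneg {f : Lp ℂ ∞ μ} (hf : ∀ᵐ x ∂μ, 0 ≤ f x) (ξ : Lp ℂ 2 μ) :
    (0 : ℂ) ≤ inner ℂ ξ (mulOp f ξ) := by
  rw [L2.inner_def]
  have : (∫ x, (inner ℂ (ξ x) (mulOp f ξ x) : ℂ) ∂μ)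
      = ((∫ x, (f x).re * ‖ξ x‖ ^ 2 ∂μ : ℝ) : ℂ) := by
    rw [← integral_complex_ofReal]
    apply integral_congr_ae
    filter_upwards [hf, coeFn_mulOp f ξ] with x h1 h2
    rw [h2, RCLike.inner_apply]
    have h3 : f x = ((f x).re : ℂ) :=
      Complex.ext rfl (by simpa using (Complex.nonneg_iff.1 h1).2.symm)
    have h4 : ξ x * (starRingEnd ℂ) (ξ x) = (‖ξ x‖ : ℂ) ^ 2 := RCLike.mul_conj _
    push_cast
    rw [← h3, ← h4]
    ring
  rw [this]
  refine Complex.zero_le_real.2 (integral_nonneg_of_ae ?_)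
  filter_upwards [hf] with x h1
  exact mul_nonneg (Complex.nonneg_iff.1 h1).1 (sq_nonneg _)

/-- The square-integrable vector `1_A v`, for a strictly positive `v`, as a test vector: the
quadratic form of a multiplication operator at `1_A v` is an integral over `A`. -/
theorem inner_mulOp_indicator (f : Lp ℂ ∞ μ) {v : X → ℝ} (hv : MemLp (fun x => (v x : ℂ)) 2 μ)
    {A : Set X} (hA : MeasurableSet A) :
    inner ℂ ((hv.indicator hA).toLp _) (mulOp f ((hv.indicator hA).toLp _)) =
      ∫ x in A, f x * (v x : ℂ) ^ 2 ∂μ := by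
  rw [L2.inner_def, ← integral_indicator hA]
  apply integral_congr_ae
  filter_upwards [coeFn_mulOp f ((hv.indicator hA).toLp _), (hv.indicator hA).coeFn_toLp]
    with x h1 h2
  rw [h1, h2, RCLike.inner_apply]
  by_cases hx : x ∈ A
  · simp [hx]
    ring
  · simp [hx]

theorem integrable_mul_sq (f : Lp ℂ ∞ μ) {v : X → ℝ} (hv : MemLp (fun x => (v x : ℂ)) 2 μ) :
    Integrable (fun x => f x * (v x : ℂ) ^ 2) μ := by
  have h : Integrable (fun x => (v x : ℂ) ^ 2) μ := by
    refine ((memLp_two_iff_integrable_sq_norm hv.1).1 hv).mono (hv.1.pow 2) ?_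
    filter_upwards with x
    simp
  exact h.bdd_mul (Lp.aestronglyMeasurable f) (ae_norm_le_norm f)

theorem nonneg_of_inner_mulOp_nonneg [SigmaFinite μ] {f : Lp ℂ ∞ μ}
    (hf : ∀ ξ : Lp ℂ 2 μ, (0 : ℂ) ≤ inner ℂ ξ (mulOp f ξ)) : ∀ᵐ x ∂μ, 0 ≤ f x := by
  obtain ⟨v, hv0, -, hv⟩ := exists_pos_memLp_two μ
  have hi := integrable_mul_sq f hv
  have hA : ∀ A, MeasurableSet A → (0 : ℂ) ≤ ∫ x in A, f x * (v x : ℂ) ^ 2 ∂μ := fun A h =>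
    inner_mulOp_indicator f hv h ▸ hf _
  have hre : ∀ A, MeasurableSet A → (∫ x in A, (f x * (v x : ℂ) ^ 2).re ∂μ) =
      (∫ x in A, f x * (v x : ℂ) ^ 2 ∂μ).re := fun A h => integral_re hi.integrableOn
  have him : ∀ A, MeasurableSet A → (∫ x in A, (f x * (v x : ℂ) ^ 2).im ∂μ) = 0 := fun A h =>
    (integral_im hi.integrableOn).trans (Complex.nonneg_iff.1 (hA A h)).2.symm
  have h1 := ae_nonneg_of_forall_setIntegral_nonneg hi.re
    fun A h _ => (Complex.nonneg_iff.1 (hA A h)).1.trans_eq (hre A h).symm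
  have h2 := ae_nonneg_of_forall_setIntegral_nonneg hi.im fun A h _ => (him A h).ge
  have h3 := ae_nonneg_of_forall_setIntegral_nonneg hi.im.neg fun A h _ => by
    simp only [Pi.neg_apply, integral_neg]
    exact neg_nonneg.2 (him A h).le
  filter_upwards [h1, h2, h3] with x h1 h2 h3
  have hvx : (0 : ℝ) < v x ^ 2 := pow_pos (hv0 x) 2
  simp only [Pi.zero_apply, Pi.neg_apply, ← Complex.ofReal_pow, RCLike.re_to_complex,
    RCLike.im_to_complex, Complex.re_mul_ofReal, Complex.im_mul_ofReal] at h1 h2 h3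
  refine Complex.nonneg_iff.2 ⟨?_, ?_⟩
  · exact nonneg_of_mul_nonneg_left h1 hvx
  · exact le_antisymm (nonneg_of_mul_nonneg_left h2 hvx)
      (neg_nonneg.1 (nonneg_of_mul_nonneg_left (by linarith) hvx))

end MulOp

/-! ### The Koopman isometries of a non-singular action -/

section Koopman

variable {Γ : Type*} [Group Γ] {X : Type*} [MeasurableSpace X] [MulAction Γ X] {μ : Measure X}

/-- The square root of the Radon–Nikodym derivative `d(s_* μ) / dμ`. -/
noncomputable def koopmanWeight (μ : Measure X) (s : Γ) (x : X) : ℝ :=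
  Real.sqrt ((μ.map fun y => s • y).rnDeriv μ x).toReal

theorem measurable_koopmanWeight (s : Γ) : Measurable (koopmanWeight μ s) :=
  (Measure.measurable_rnDeriv _ _).ennreal_toReal.sqrt

end Koopman

section Koopman

variable {Γ : Type*} [Group Γ] {X : Type*} [MeasurableSpace X] [MulAction Γ X]
  {μ : Measure X} [NonsingularAction Γ μ]

theorem ae_smul (s : Γ) {p : X → Prop} (h : ∀ᵐ x ∂μ, p x) : ∀ᵐ x ∂μ, p (s • x) :=
  (NonsingularAction.quasiMeasurePreserving (μ := μ) s).ae h

theorem translate_translate_inv (s : Γ) (f : Lp ℂ ∞ μ) : translate s (translate s⁻¹ f) = f := by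
  apply Lp.ext
  filter_upwards [coeFn_translate s (translate s⁻¹ f), ae_smul s⁻¹ (coeFn_translate s⁻¹ f)]
    with x h1 h2
  rw [h1, h2, smul_smul, inv_inv, mul_inv_cancel, one_smul]

theorem translate_mul (s t : Γ) (f : Lp ℂ ∞ μ) :
    translate (s * t) f = translate s (translate t f) := by
  apply Lp.ext
  filter_upwards [coeFn_translate s (translate t f), ae_smul s⁻¹ (coeFn_translate t f),
    coeFn_translate (s * t) f] with x h1 h2 h3
  rw [h1, h2, h3, smul_smul, mul_inv_rev]

theorem translate_zero (s : Γ) : translate s (0 : Lp ℂ ∞ μ) = 0 := by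
  apply Lp.ext
  filter_upwards [coeFn_translate s (0 : Lp ℂ ∞ μ), ae_smul s⁻¹ (Lp.coeFn_zero ℂ ∞ μ),
    Lp.coeFn_zero ℂ ∞ μ] with x h1 h2 h3
  rw [h1, h2, h3]
  rfl

theorem translate_star (s : Γ) (f : Lp ℂ ∞ μ) : translate s (star f) = star (translate s f) := by
  apply Lp.ext
  filter_upwards [coeFn_translate s (star f), ae_smul s⁻¹ (Lp.coeFn_star f),
    Lp.coeFn_star (translate s f), coeFn_translate s f] with x h1 h2 h3 h4
  rw [h1, h2, h3, Pi.star_apply, Pi.star_apply, h4]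

theorem sigmaFinite_map_smul [SigmaFinite μ] (s : Γ) : SigmaFinite (μ.map fun y => s • y) := by
  let e : X ≃ᵐ X :=
    { toEquiv := MulAction.toPerm s
      measurable_toFun := (NonsingularAction.quasiMeasurePreserving (μ := μ) s).measurable
      measurable_invFun := (NonsingularAction.quasiMeasurePreserving (μ := μ) s⁻¹).measurable }
  exact e.sigmaFinite_map

theorem lintegral_koopman [SigmaFinite μ] (s : Γ) (ξ : Lp ℂ 2 μ) :
    ∫⁻ x, ‖(koopmanWeight μ s x : ℂ) * ξ (s⁻¹ • x)‖ₑ ^ (2 : ℝ) ∂μ =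
      ∫⁻ x, ‖ξ x‖ₑ ^ (2 : ℝ) ∂μ := by
  have hs := NonsingularAction.quasiMeasurePreserving (μ := μ) s
  have hs' := NonsingularAction.quasiMeasurePreserving (μ := μ) s⁻¹
  have := sigmaFinite_map_smul (μ := μ) s
  have hm : Measurable fun x => ‖ξ (s⁻¹ • x)‖ₑ ^ (2 : ℝ) :=
    (((Lp.stronglyMeasurable ξ).measurable.comp hs'.measurable).enorm).pow_const _
  calc
    _ = ∫⁻ x, (μ.map fun y => s • y).rnDeriv μ x * ‖ξ (s⁻¹ • x)‖ₑ ^ (2 : ℝ) ∂μ := by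
      apply lintegral_congr_ae
      filter_upwards [Measure.rnDeriv_lt_top (μ.map fun y => s • y) μ] with x hx
      rw [enorm_mul, ENNReal.mul_rpow_of_nonneg _ _ (by norm_num)]
      congr 1
      rw [koopmanWeight, ← ofReal_norm, Complex.norm_real,
        Real.norm_of_nonneg (Real.sqrt_nonneg _), ENNReal.ofReal_rpow_of_nonneg
        (Real.sqrt_nonneg _) (by norm_num), Real.rpow_two, Real.sq_sqrt ENNReal.toReal_nonneg,
        ENNReal.ofReal_toReal hx.ne]
    _ = ∫⁻ x, ‖ξ (s⁻¹ • x)‖ₑ ^ (2 : ℝ) ∂(μ.map fun y => s • y) :=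
      lintegral_rnDeriv_mul hs.absolutelyContinuous hm.aemeasurable
    _ = _ := by
      rw [lintegral_map hm hs.measurable]
      simp

theorem eLpNorm_koopman [SigmaFinite μ] (s : Γ) (ξ : Lp ℂ 2 μ) :
    eLpNorm (fun x => (koopmanWeight μ s x : ℂ) * ξ (s⁻¹ • x)) 2 μ = eLpNorm ξ 2 μ := by
  rw [eLpNorm_eq_lintegral_rpow_enorm_toReal two_ne_zero ENNReal.ofNat_ne_top,
    eLpNorm_eq_lintegral_rpow_enorm_toReal two_ne_zero ENNReal.ofNat_ne_top, ENNReal.toReal_ofNat,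
    lintegral_koopman]

theorem memLp_koopman [SigmaFinite μ] (s : Γ) (ξ : Lp ℂ 2 μ) :
    MemLp (fun x => (koopmanWeight μ s x : ℂ) * ξ (s⁻¹ • x)) 2 μ := by
  refine ⟨?_, by rw [eLpNorm_koopman]; exact Lp.eLpNorm_lt_top ξ⟩
  have hs' := NonsingularAction.quasiMeasurePreserving (μ := μ) s⁻¹
  exact ((Complex.measurable_ofReal.comp (measurable_koopmanWeight s)).mul
    ((Lp.stronglyMeasurable ξ).measurable.comp hs'.measurable)).aestronglyMeasurable

/-- The isometry `(U_s ξ)(x) = (d(s_* μ)/dμ)(x)^{1/2} ξ(s⁻¹ x)` of `L²(X, μ)`. -/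
noncomputable def koopman [SigmaFinite μ] (s : Γ) : Lp ℂ 2 μ →ₗᵢ[ℂ] Lp ℂ 2 μ where
  toFun ξ := (memLp_koopman s ξ).toLp _
  map_add' ξ η := by
    apply Lp.ext
    filter_upwards [(memLp_koopman s ξ).coeFn_toLp, (memLp_koopman s η).coeFn_toLp,
      (memLp_koopman s (ξ + η)).coeFn_toLp, Lp.coeFn_add ((memLp_koopman s ξ).toLp _)
      ((memLp_koopman s η).toLp _), ae_smul s⁻¹ (Lp.coeFn_add ξ η)] with x h1 h2 h3 h4 h5
    rw [h3, h4, h5, Pi.add_apply, Pi.add_apply, h1, h2, mul_add]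
  map_smul' c ξ := by
    apply Lp.ext
    filter_upwards [(memLp_koopman s ξ).coeFn_toLp, (memLp_koopman s (c • ξ)).coeFn_toLp,
      Lp.coeFn_smul c ((memLp_koopman s ξ).toLp _), ae_smul s⁻¹ (Lp.coeFn_smul c ξ)]
      with x h1 h2 h3 h4
    rw [RingHom.id_apply, h2, h3, h4, Pi.smul_apply, Pi.smul_apply, h1, smul_eq_mul, smul_eq_mul,
      mul_left_comm]
  norm_map' ξ := by
    change ‖(memLp_koopman s ξ).toLp _‖ = ‖ξ‖
    rw [Lp.norm_toLp, eLpNorm_koopman, Lp.norm_def]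

theorem coeFn_koopman [SigmaFinite μ] (s : Γ) (ξ : Lp ℂ 2 μ) :
    koopman s ξ =ᵐ[μ] fun x => (koopmanWeight μ s x : ℂ) * ξ (s⁻¹ • x) :=
  (memLp_koopman s ξ).coeFn_toLp

/-- Conjugation by the Koopman isometry implements the translation of `L^∞(X, μ)`. -/
theorem koopman_mulOp [SigmaFinite μ] (s : Γ) (f : Lp ℂ ∞ μ) (ξ : Lp ℂ 2 μ) :
    koopman s (mulOp f ξ) = mulOp (translate s f) (koopman s ξ) := by
  apply Lp.ext
  filter_upwards [coeFn_koopman s (mulOp f ξ), ae_smul s⁻¹ (coeFn_mulOp f ξ),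
    coeFn_mulOp (translate s f) (koopman s ξ), coeFn_koopman s ξ, coeFn_translate s f]
    with x h1 h2 h3 h4 h5
  rw [h1, h2, h3, h4, h5]
  ring

end Koopman

/-! ### The commutant of the crossed product -/

section Commutant

variable {Γ : Type*} [Group Γ] {X : Type*} [MeasurableSpace X] {μ : Measure X}

theorem star_leftReg (s : Γ) : star (leftReg μ s) = leftReg μ s⁻¹ := by
  rw [ContinuousLinearMap.star_eq_adjoint]
  symm
  rw [ContinuousLinearMap.eq_adjoint_iff]
  intro ξ η
  rw [lp.inner_eq_tsum, lp.inner_eq_tsum, ← (Equiv.mulLeft s⁻¹).tsum_eq]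
  refine tsum_congr fun t => ?_
  rw [leftReg_apply, leftReg_apply, inv_inv, Equiv.coe_mulLeft, mul_inv_cancel_left]

theorem norm_leftReg_apply (s : Γ) (ξ : RegHilbert Γ μ) : ‖leftReg μ s ξ‖ = ‖ξ‖ := by
  refine (Real.rpow_left_inj (norm_nonneg _) (norm_nonneg _) two_toReal_pos.ne').1 ?_
  rw [lp.norm_rpow_eq_tsum two_toReal_pos ξ, lp.norm_rpow_eq_tsum two_toReal_pos]
  exact (Equiv.mulLeft s⁻¹).tsum_eq fun t => ‖ξ t‖ ^ (2 : ℝ≥0∞).toReal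

/-- The operator `1 ⊗ g` on `ℓ²(Γ) ⊗ L²(X, μ)`, which belongs to the commutant of the crossed
product. -/
noncomputable abbrev diagConst (Γ : Type*) (g : Lp ℂ ∞ μ) : RegHilbert Γ μ →L[ℂ] RegHilbert Γ μ :=
  diagOp (fun _ : Γ => mulOp g) ‖g‖ (norm_nonneg g) fun _ => norm_mulOp_apply_le g

theorem embedOne_mulOp (g : Lp ℂ ∞ μ) (ξ : Lp ℂ 2 μ) :
    embedOne Γ μ (mulOp g ξ) = diagConst Γ g (embedOne Γ μ ξ) := by
  refine lp.ext (funext fun t => ?_)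
  rw [diagOp_apply]
  by_cases ht : t = 1
  · subst ht
    rw [embedOne_apply_one, embedOne_apply_one]
  · rw [embedOne_apply_ne _ ht, embedOne_apply_ne _ ht, map_zero]

theorem norm_embedOne (ξ : Lp ℂ 2 μ) : ‖embedOne Γ μ ξ‖ = ‖ξ‖ := by
  classical
  exact lp.norm_single (E := fun _ : Γ => Lp ℂ 2 μ) (p := 2) (by norm_num) 1 ξ

end Commutant

section Commutant

variable {Γ : Type*} [Group Γ] {X : Type*} [MeasurableSpace X] [MulAction Γ X]
  {μ : Measure X} [NonsingularAction Γ μ]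

theorem star_embedLInfty (f : Lp ℂ ∞ μ) : star (embedLInfty Γ f) = embedLInfty Γ (star f) := by
  rw [ContinuousLinearMap.star_eq_adjoint]
  symm
  rw [ContinuousLinearMap.eq_adjoint_iff]
  intro ξ η
  rw [lp.inner_eq_tsum, lp.inner_eq_tsum]
  refine tsum_congr fun t => ?_
  rw [embedLInfty, embedLInfty, diagOp_apply, diagOp_apply, translate_star, inner_mulOp]

/-- The operator `(R_s ξ)(t) = U_s ξ(t s)`, which belongs to the commutant of the crossed
product. -/
noncomputable def rightReg [SigmaFinite μ] (s : Γ) : RegHilbert Γ μ →L[ℂ] RegHilbert Γ μ :=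
  LinearMap.mkContinuous
    { toFun := fun ξ => ⟨fun t => koopman s (ξ (t * s)), memℓp_gen (by
        have h : Summable fun t => ‖ξ (t * s)‖ ^ (2 : ℝ≥0∞).toReal :=
          (Equiv.mulRight s).summable_iff.2 (summable_regHilbert ξ)
        refine h.congr fun t => ?_
        rw [LinearIsometry.norm_map])⟩
      map_add' := fun ξ η => lp.ext (funext fun t => map_add (koopman s) _ _)
      map_smul' := fun c ξ => lp.ext (funext fun t => map_smul (koopman s) c _) }
    1 fun ξ => by
      rw [one_mul]
      refine lp.norm_le_of_tsum_le two_toReal_pos (norm_nonneg ξ) ?_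
      rw [lp.norm_rpow_eq_tsum two_toReal_pos ξ]
      refine Eq.le ?_
      rw [← (Equiv.mulRight s).tsum_eq fun t => ‖ξ t‖ ^ (2 : ℝ≥0∞).toReal]
      refine tsum_congr fun t => ?_
      change ‖koopman s (ξ (t * s))‖ ^ _ = _
      rw [LinearIsometry.norm_map, Equiv.coe_mulRight]

theorem rightReg_apply [SigmaFinite μ] (s : Γ) (ξ : RegHilbert Γ μ) (t : Γ) :
    rightReg s ξ t = koopman s (ξ (t * s)) := rfl

theorem rightReg_commute_leftReg [SigmaFinite μ] (s r : Γ) :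
    leftReg μ r * rightReg s = rightReg s * leftReg μ r := by
  refine ContinuousLinearMap.ext fun ξ => lp.ext (funext fun t => ?_)
  rw [mul_apply_eq_comp, mul_apply_eq_comp, leftReg_apply, rightReg_apply, rightReg_apply,
    leftReg_apply, mul_assoc]

theorem rightReg_commute_embedLInfty [SigmaFinite μ] (s : Γ) (f : Lp ℂ ∞ μ) :
    embedLInfty Γ f * rightReg s = rightReg s * embedLInfty Γ f := by
  refine ContinuousLinearMap.ext fun ξ => lp.ext (funext fun t => ?_)
  rw [mul_apply_eq_comp, mul_apply_eq_comp, embedLInfty, diagOp_apply, rightReg_apply,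
    rightReg_apply, diagOp_apply, koopman_mulOp, ← translate_mul, mul_inv_rev, mul_inv_cancel_left]

theorem crossedProduct_commute_rightReg [SigmaFinite μ] {T : RegHilbert Γ μ →L[ℂ] RegHilbert Γ μ}
    (hT : T ∈ crossedProduct Γ μ) (s : Γ) : rightReg s * T = T * rightReg s := by
  have key : ∀ g ∈ Set.range (leftReg (Γ := Γ) μ) ∪ Set.range (embedLInfty (μ := μ) Γ),
      g * rightReg s = rightReg s * g ∧ star g * rightReg s = rightReg s * star g := by
    rintro _ (⟨r, rfl⟩ | ⟨f, rfl⟩)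
    · rw [star_leftReg]
      exact ⟨rightReg_commute_leftReg s r, rightReg_commute_leftReg s r⁻¹⟩
    · rw [star_embedLInfty]
      exact ⟨rightReg_commute_embedLInfty s f, rightReg_commute_embedLInfty s (star f)⟩
  refine commute_generatedVN _ hT (fun g hg => (key g hg).1) fun g hg => ?_
  have h := congrArg star (key g hg).2
  rwa [star_mul, star_mul, star_star, eq_comm] at h

theorem crossedProduct_commute_diagConst {T : RegHilbert Γ μ →L[ℂ] RegHilbert Γ μ}
    (hT : T ∈ crossedProduct Γ μ) (g : Lp ℂ ∞ μ) (ξ : RegHilbert Γ μ) :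
    T (diagConst Γ g ξ) = diagConst Γ g (T ξ) := by
  have h := commute_generatedVN _ hT (gen_commute (Γ := Γ) g)
    (by rw [diagConst_adjoint]; exact gen_commute (Γ := Γ) (star g))
  rw [← mul_apply_eq_comp, ← mul_apply_eq_comp, h]

/-- An element `w` of the crossed product is determined on the vectors `δ_{s⁻¹} ⊗ U_s ξ` by its
values on the vectors `δ_e ⊗ ξ`. -/
theorem crossedProduct_apply_leftReg_embedOne [SigmaFinite μ]
    {T : RegHilbert Γ μ →L[ℂ] RegHilbert Γ μ} (hT : T ∈ crossedProduct Γ μ) (s : Γ)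
    (ξ : Lp ℂ 2 μ) :
    T (leftReg μ s⁻¹ (embedOne Γ μ (koopman s ξ))) = rightReg s (T (embedOne Γ μ ξ)) := by
  have h : leftReg μ s⁻¹ (embedOne Γ μ (koopman s ξ)) = rightReg s (embedOne Γ μ ξ) := by
    refine lp.ext (funext fun t => ?_)
    rw [leftReg_apply, rightReg_apply, inv_inv]
    by_cases ht : t = s⁻¹
    · subst ht
      rw [mul_inv_cancel, inv_mul_cancel, embedOne_apply_one, embedOne_apply_one]
    · rw [embedOne_apply_ne _ fun h => ht (eq_inv_of_mul_eq_one_right h),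
        embedOne_apply_ne _ fun h => ht (eq_inv_of_mul_eq_one_left h), map_zero]
  rw [h]
  rw [← mul_apply_eq_comp, ← crossedProduct_commute_rightReg hT s, mul_apply_eq_comp]

/-- In the expansion `w (δ_e ⊗ ξ) = ∑ₜ δ_t ⊗ wᵗ ξ` the coefficients can be read off. -/
theorem mulOp_coeff_apply [SigmaFinite μ] (w : crossedProduct Γ μ) (t : Γ) (ξ : Lp ℂ 2 μ) :
    mulOp (coeff w t) ξ = (w : RegHilbert Γ μ →L[ℂ] RegHilbert Γ μ) (embedOne Γ μ ξ) t := by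
  rw [← mulOp_coeff, compress_apply, star_leftReg, mul_apply_eq_comp, leftReg_apply, inv_inv,
    mul_one]

end Commutant

/-! ### The conjugation action and the coset space -/

section Conjugation

variable {Γ : Type*} [Group Γ]

/-- A conjugacy-invariant set `Ω` maps equivariantly to the disjoint union of the coset spaces of
the centralizers of its elements: `g r g⁻¹` is sent to `g C(r)`, where `r` is a chosen
representative of the conjugacy class. -/
theorem exists_equivariant_map_cosetUnion (Ω : Set Γ)
    (hΩ : ∀ s t : Γ, t ∈ Ω → s * t * s⁻¹ ∈ Ω) :
    ∃ π : Ω → CosetUnion {Λ : Subgroup Γ | ∃ t ∈ Ω, Λ = Subgroup.centralizer ({t} : Set Γ)},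
      ∀ (s : Γ) (t : Ω), π ⟨s * t * s⁻¹, hΩ s t t.2⟩ = s • π t := by
  let 𝒞 : Set (Subgroup Γ) := {Λ | ∃ t ∈ Ω, Λ = Subgroup.centralizer ({t} : Set Γ)}
  let κ : (r : Γ) → r ∈ Ω → Γ → CosetUnion 𝒞 := fun r hr g =>
    ⟨⟨Subgroup.centralizer {r}, r, hr, rfl⟩, (g : Γ ⧸ Subgroup.centralizer {r})⟩
  have hκ : ∀ (r r' : Γ) (hr : r ∈ Ω) (hr' : r' ∈ Ω) (g g' : Γ), r = r' →
      g * r * g⁻¹ = g' * r' * g'⁻¹ → κ r hr g = κ r' hr' g' := by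
    rintro r _ hr hr' g g' rfl h
    refine Sigma.ext rfl (heq_of_eq (QuotientGroup.eq.2 ?_))
    rw [Subgroup.mem_centralizer_singleton_iff]
    have h' : g⁻¹ * (g * r * g⁻¹) * g' = g⁻¹ * (g' * r * g'⁻¹) * g' := by rw [h]
    simpa [mul_assoc] using h'.symm
  have hex : ∀ t : Ω, ∃ g : Γ, g * (ConjClasses.mk (t : Γ)).out * g⁻¹ = t := fun t =>
    isConj_iff.1 (ConjClasses.mk_eq_mk_iff_isConj.1 (Quotient.out_eq (ConjClasses.mk (t : Γ))))
  choose g hg using hex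
  have hr : ∀ t : Ω, (ConjClasses.mk (t : Γ)).out ∈ Ω := fun t => by
    have h := hΩ (g t)⁻¹ t t.2
    rw [← hg t] at h
    simpa [mul_assoc] using h
  refine ⟨fun t => κ _ (hr t) (g t), fun s t => ?_⟩
  change _ = κ _ (hr t) (s * g t)
  refine hκ _ _ (hr _) (hr t) _ _ (congrArg Quotient.out ?_) ?_
  · exact ConjClasses.mk_eq_mk_iff_isConj.2 (isConj_iff.2 ⟨s⁻¹, by simp [mul_assoc]⟩)
  · rw [hg]
    calc s * t * s⁻¹ = s * (g t * (ConjClasses.mk (t : Γ)).out * (g t)⁻¹) * s⁻¹ := by rw [hg]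
      _ = _ := by simp only [mul_assoc, mul_inv_rev]

end Conjugation

/-! ### Multiplication by functions on `Ω × X` -/

section FiberOp

variable {Γ : Type*} {X : Type*} [MeasurableSpace X] {μ : Measure X} {K : Type*} {Ω : Set Γ}

theorem norm_diagOp_le (A : Γ → Lp ℂ 2 μ →L[ℂ] Lp ℂ 2 μ) (C : ℝ) (hC : 0 ≤ C)
    (hA : ∀ t ξ, ‖A t ξ‖ ≤ C * ‖ξ‖) : ‖diagOp A C hC hA‖ ≤ C := by
  refine ContinuousLinearMap.opNorm_le_bound _ hC fun ξ => ?_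
  have h : ‖(C : ℂ) • ξ‖ = C * ‖ξ‖ := by
    rw [norm_smul, Complex.norm_real, Real.norm_of_nonneg hC]
  rw [← h]
  refine lp.norm_mono two_ne_zero fun t => ?_
  rw [diagOp_apply, lp.coeFn_smul, Pi.smul_apply, norm_smul, Complex.norm_real,
    Real.norm_of_nonneg hC]
  exact hA t (ξ t)

open Classical in
/-- The pullback to `Γ × X` of `F ∈ L^∞(K × X)` along a map `π : Ω → K`, extended by zero outside
of `Ω`. -/
noncomputable def pullback (π : Ω → K) (F : LInftyProd K μ) (t : Γ) : Lp ℂ ∞ μ :=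
  if h : t ∈ Ω then F (π ⟨t, h⟩) else 0

theorem pullback_of_mem (π : Ω → K) (F : LInftyProd K μ) {t : Γ} (h : t ∈ Ω) :
    pullback π F t = F (π ⟨t, h⟩) := dif_pos h

theorem pullback_of_notMem (π : Ω → K) (F : LInftyProd K μ) {t : Γ} (h : t ∉ Ω) :
    pullback π F t = 0 := dif_neg h

theorem norm_pullback_le (π : Ω → K) (F : LInftyProd K μ) (t : Γ) : ‖pullback π F t‖ ≤ ‖F‖ := by
  by_cases h : t ∈ Ω
  · rw [pullback_of_mem π F h]
    exact lp.norm_apply_le_norm ENNReal.top_ne_zero F _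
  · rw [pullback_of_notMem π F h, norm_zero]
    exact norm_nonneg F

/-- The operator on `ℓ²(Γ) ⊗ L²(X, μ) = L²(Γ × X)` of multiplication by the pullback of
`F ∈ L^∞(K × X)`. -/
noncomputable def fiberOp (π : Ω → K) (F : LInftyProd K μ) :
    RegHilbert Γ μ →L[ℂ] RegHilbert Γ μ :=
  diagOp (fun t => mulOp (pullback π F t)) ‖F‖ (norm_nonneg F) fun t ξ =>
    (norm_mulOp_apply_le _ ξ).trans (by gcongr; exact norm_pullback_le π F t)

theorem fiberOp_apply (π : Ω → K) (F : LInftyProd K μ) (ξ : RegHilbert Γ μ) (t : Γ) :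
    fiberOp π F ξ t = mulOp (pullback π F t) (ξ t) := rfl

theorem norm_fiberOp_le (π : Ω → K) (F : LInftyProd K μ) : ‖fiberOp π F‖ ≤ ‖F‖ :=
  norm_diagOp_le _ _ _ _

theorem fiberOp_add (π : Ω → K) (F G : LInftyProd K μ) :
    fiberOp π (F + G) = fiberOp π F + fiberOp π G := by
  refine ContinuousLinearMap.ext fun ξ => lp.ext (funext fun t => ?_)
  change mulOp (pullback π (F + G) t) (ξ t) =
    mulOp (pullback π F t) (ξ t) + mulOp (pullback π G t) (ξ t)
  rw [← add_apply, ← mulOp_add]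
  by_cases h : t ∈ Ω
  · simp only [pullback_of_mem π _ h]
    rfl
  · simp only [pullback_of_notMem π _ h, add_zero]

theorem fiberOp_smul (π : Ω → K) (c : ℂ) (F : LInftyProd K μ) :
    fiberOp π (c • F) = c • fiberOp π F := by
  refine ContinuousLinearMap.ext fun ξ => lp.ext (funext fun t => ?_)
  change mulOp (pullback π (c • F) t) (ξ t) = c • mulOp (pullback π F t) (ξ t)
  rw [← smul_apply, ← mulOp_smul]
  by_cases h : t ∈ Ω
  · simp only [pullback_of_mem π _ h]
    rfl
  · simp only [pullback_of_notMem π _ h, smul_zero]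

theorem inner_fiberOp_nonneg (π : Ω → K) {F : LInftyProd K μ} (hF : ∀ k, ∀ᵐ x ∂μ, 0 ≤ F k x)
    (ξ : RegHilbert Γ μ) : (0 : ℂ) ≤ inner ℂ ξ (fiberOp π F ξ) := by
  rw [lp.inner_eq_tsum]
  refine tsum_nonneg fun t => ?_
  rw [fiberOp_apply]
  refine inner_mulOp_nonneg ?_ _
  by_cases h : t ∈ Ω
  · rw [pullback_of_mem π F h]
    exact hF _
  · rw [pullback_of_notMem π F h]
    filter_upwards [Lp.coeFn_zero ℂ ∞ μ] with x hx
    rw [hx]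
    rfl

theorem fiberOp_diagConst (π : Ω → K) (F : LInftyProd K μ) (g : Lp ℂ ∞ μ) (ξ : RegHilbert Γ μ) :
    fiberOp π F (diagConst Γ g ξ) = diagConst Γ g (fiberOp π F ξ) :=
  lp.ext (funext fun _ => mulOp_comm _ _ _)

theorem inner_diagConst (g : Lp ℂ ∞ μ) (ξ η : RegHilbert Γ μ) :
    inner ℂ (diagConst Γ (star g) ξ) η = inner ℂ ξ (diagConst Γ g η) := by
  rw [lp.inner_eq_tsum, lp.inner_eq_tsum]
  exact tsum_congr fun t => inner_mulOp g (ξ t) (η t)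

/-- The constant function `1` in `L^∞(X, μ)`. -/
noncomputable def oneLp (μ : Measure X) : Lp ℂ ∞ μ := (memLp_top_const (1 : ℂ)).toLp _

theorem coeFn_oneLp : oneLp μ =ᵐ[μ] fun _ => 1 := (memLp_top_const (1 : ℂ)).coeFn_toLp

theorem mulOp_oneLp (ξ : Lp ℂ 2 μ) : mulOp (oneLp μ) ξ = ξ := by
  apply Lp.ext
  filter_upwards [coeFn_mulOp (oneLp μ) ξ, coeFn_oneLp (μ := μ)] with x h1 h2
  rw [h1, h2, one_mul]

theorem mulOp_pullback_one_of_mem (π : Ω → K) {t : Γ} (ht : t ∈ Ω) (ξ : Lp ℂ 2 μ) :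
    mulOp (pullback π (oneTensor K (oneLp μ)) t) ξ = ξ := by
  rw [pullback_of_mem π _ ht]
  exact mulOp_oneLp ξ

theorem mulOp_pullback_one_of_notMem (π : Ω → K) {t : Γ} (ht : t ∉ Ω) (ξ : Lp ℂ 2 μ) :
    mulOp (pullback π (oneTensor K (oneLp μ)) t) ξ = 0 := by
  rw [pullback_of_notMem π _ ht, mulOp_zero]
  rfl

/-- For the constant function `1`, the operator `D_F` is the projection onto `ℓ²(Ω) ⊗ L²(X)`. -/
theorem inner_fiberOp_one (π : Ω → K) (ζ : RegHilbert Γ μ) :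
    inner ℂ ζ (fiberOp π (oneTensor K (oneLp μ)) ζ) =
      ((‖fiberOp π (oneTensor K (oneLp μ)) ζ‖ ^ 2 : ℝ) : ℂ) := by
  refine Eq.trans ?_ ((inner_self_eq_norm_sq_to_K (𝕜 := ℂ)
    (fiberOp π (oneTensor K (oneLp μ)) ζ)).trans (by rw [Complex.ofReal_pow]; rfl))
  rw [lp.inner_eq_tsum, lp.inner_eq_tsum]
  refine tsum_congr fun t => ?_
  rw [fiberOp_apply]
  by_cases ht : t ∈ Ω
  · rw [mulOp_pullback_one_of_mem π ht]
  · rw [mulOp_pullback_one_of_notMem π ht, inner_zero_right, inner_zero_right]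

theorem fiberOp_oneTensor (π : Ω → K) (f : Lp ℂ ∞ μ) (ξ : RegHilbert Γ μ) :
    fiberOp π (oneTensor K f) ξ = fiberOp π (oneTensor K (oneLp μ)) (diagConst Γ f ξ) := by
  refine lp.ext (funext fun t => ?_)
  rw [fiberOp_apply, fiberOp_apply, diagOp_apply]
  by_cases h : t ∈ Ω
  · rw [mulOp_pullback_one_of_mem π h, pullback_of_mem π _ h]
    rfl
  · rw [mulOp_pullback_one_of_notMem π h, pullback_of_notMem π _ h, mulOp_zero]
    rfl

end FiberOp

section FiberOp

variable {Γ : Type*} [Group Γ] {X : Type*} [MeasurableSpace X] [MulAction Γ X] {μ : Measure X}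
  [NonsingularAction Γ μ] {K : Type*} [MulAction Γ K] {Ω : Set Γ}

theorem pullback_diagTranslate (hΩ : ∀ s t : Γ, t ∈ Ω → s * t * s⁻¹ ∈ Ω) {π : Ω → K}
    (hπ : ∀ (s : Γ) (t : Ω), π ⟨s * t * s⁻¹, hΩ s t t.2⟩ = s • π t) (F : LInftyProd K μ)
    (s t : Γ) :
    pullback π (diagTranslate s F) (s * t * s⁻¹) = translate s (pullback π F t) := by
  by_cases h : t ∈ Ω
  · rw [pullback_of_mem π _ h, pullback_of_mem π _ (hΩ s t h)]
    change translate s (F (s⁻¹ • π ⟨s * t * s⁻¹, hΩ s t h⟩)) = _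
    rw [hπ s ⟨t, h⟩, inv_smul_smul]
  · rw [pullback_of_notMem π _ h, pullback_of_notMem π _ fun h' => h ?_, translate_zero]
    simpa [mul_assoc] using hΩ s⁻¹ _ h'

/-- The isometry `λ(s) R_s` intertwines multiplication by `F` and by its translate `s · F`. -/
theorem inner_fiberOp_diagTranslate [SigmaFinite μ] (hΩ : ∀ s t : Γ, t ∈ Ω → s * t * s⁻¹ ∈ Ω)
    {π : Ω → K} (hπ : ∀ (s : Γ) (t : Ω), π ⟨s * t * s⁻¹, hΩ s t t.2⟩ = s • π t)
    (F : LInftyProd K μ) (s : Γ) (ξ η : RegHilbert Γ μ) :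
    inner ℂ (leftReg μ s (rightReg s ξ))
      (fiberOp π (diagTranslate s F) (leftReg μ s (rightReg s η))) =
    inner ℂ ξ (fiberOp π F η) := by
  rw [lp.inner_eq_tsum, lp.inner_eq_tsum, ← (MulAut.conj s).toEquiv.tsum_eq]
  refine tsum_congr fun t => ?_
  change inner ℂ (leftReg μ s (rightReg s ξ) (s * t * s⁻¹)) (fiberOp π (diagTranslate s F)
    (leftReg μ s (rightReg s η)) (s * t * s⁻¹)) = _
  have h : ∀ ζ : RegHilbert Γ μ, leftReg μ s (rightReg s ζ) (s * t * s⁻¹) = koopman s (ζ t) := by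
    intro ζ
    rw [leftReg_apply, rightReg_apply]
    simp only [mul_assoc, inv_mul_cancel, inv_mul_cancel_left, mul_one]
  rw [fiberOp_apply, fiberOp_apply, h, h, pullback_diagTranslate hΩ hπ, ← koopman_mulOp,
    LinearIsometry.inner_map_map]

end FiberOp

/-! ### Limits of the densities of a sequence in the crossed product -/

section Operators

/-- The form `⟨x, D y⟩` changes little under small perturbations of bounded vectors. -/
theorem tendsto_inner_sub_inner {H : Type*} [NormedAddCommGroup H] [InnerProductSpace ℂ H]
    {x x' y y' : ℕ → H} (D : H →L[ℂ] H) {l : Filter ℕ} {A : ℝ} (hx : ∀ n, ‖x n‖ ≤ A)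
    (hy : ∀ n, ‖y' n‖ ≤ A) (hxx : Tendsto (fun n => x n - x' n) l (𝓝 0))
    (hyy : Tendsto (fun n => y n - y' n) l (𝓝 0)) :
    Tendsto (fun n => (inner ℂ (x n) (D (y n)) : ℂ) - inner ℂ (x' n) (D (y' n))) l (𝓝 0) := by
  have h : Tendsto (fun n => A * (‖D‖ * ‖y n - y' n‖) + ‖x n - x' n‖ * (‖D‖ * A)) l (𝓝 0) := by
    simpa using ((hyy.norm.const_mul ‖D‖).const_mul A).add (hxx.norm.mul_const (‖D‖ * A))
  refine squeeze_zero_norm (fun n => ?_) h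
  have hsplit : (inner ℂ (x n) (D (y n)) : ℂ) - inner ℂ (x' n) (D (y' n)) =
      inner ℂ (x n) (D (y n - y' n)) + inner ℂ (x n - x' n) (D (y' n)) := by
    rw [map_sub, inner_sub_right, inner_sub_left]
    ring
  have hA : 0 ≤ A := (norm_nonneg _).trans (hx n)
  rw [hsplit]
  refine (norm_add_le _ _).trans (add_le_add ((norm_inner_le_norm _ _).trans ?_)
    ((norm_inner_le_norm _ _).trans ?_))
  · exact mul_le_mul (hx n) (D.le_opNorm _) (norm_nonneg _) hA
  · exact mul_le_mul_of_nonneg_left ((D.le_opNorm _).trans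
      (mul_le_mul_of_nonneg_left (hy n) (norm_nonneg _))) (norm_nonneg _)

theorem UltrastrongTendsto.tendsto_apply {H : Type*} [NormedAddCommGroup H]
    [InnerProductSpace ℂ H] {T : ℕ → H →L[ℂ] H} (hT : UltrastrongTendsto T 0) (ξ : H) :
    Tendsto (fun n => T n ξ) atTop (𝓝 0) := by
  have h := hT (Pi.single 0 ξ) (summable_of_ne_finset_zero (s := {0}) fun k hk => by
    rw [Pi.single_eq_of_ne (by simpa using hk)]
    simp)
  have h' : ∀ n, ∑' k, ‖(T n - 0) ((Pi.single 0 ξ : ℕ → H) k)‖ ^ 2 = ‖T n ξ‖ ^ 2 := by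
    intro n
    rw [tsum_eq_single 0 fun k hk => by rw [Pi.single_eq_of_ne hk]; simp]
    simp
  simp only [h'] at h
  rw [tendsto_zero_iff_norm_tendsto_zero]
  simpa using h.sqrt

end Operators

section LimitMap

variable {Γ : Type*} [Group Γ] {X : Type*} [MeasurableSpace X] {μ : Measure X} {K : Type*}
  {Ω : Set Γ}

/-- The operator `V* T* D_F T V` on `L²(X, μ)`, where `V ξ = δ_e ⊗ ξ` and `D_F` is multiplication
by the pullback of `F` along `π`. For `T = ∑ₜ λ(t) wᵗ` in the crossed product it is multiplication
by `∑_{t ∈ Ω} F(π t, ·) |wᵗ|²`. -/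
noncomputable def density (π : Ω → K) (T : RegHilbert Γ μ →L[ℂ] RegHilbert Γ μ)
    (F : LInftyProd K μ) : Lp ℂ 2 μ →L[ℂ] Lp ℂ 2 μ :=
  ContinuousLinearMap.adjoint (T ∘L embedOne Γ μ) ∘L fiberOp π F ∘L T ∘L embedOne Γ μ

theorem inner_density (π : Ω → K) (T : RegHilbert Γ μ →L[ℂ] RegHilbert Γ μ) (F : LInftyProd K μ)
    (ξ η : Lp ℂ 2 μ) : inner ℂ ξ (density π T F η) =
      inner ℂ (T (embedOne Γ μ ξ)) (fiberOp π F (T (embedOne Γ μ η))) := by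
  rw [density, ContinuousLinearMap.comp_apply, ContinuousLinearMap.adjoint_inner_right]
  rfl

theorem norm_comp_embedOne_le {T : RegHilbert Γ μ →L[ℂ] RegHilbert Γ μ} {C : ℝ} (hT : ‖T‖ ≤ C) :
    ‖T ∘L embedOne Γ μ‖ ≤ C :=
  ContinuousLinearMap.opNorm_le_bound _ ((norm_nonneg _).trans hT) fun ξ =>
    (T.le_of_opNorm_le hT _).trans_eq (congrArg _ (norm_embedOne ξ))

theorem norm_density_le (π : Ω → K) {T : RegHilbert Γ μ →L[ℂ] RegHilbert Γ μ} {C : ℝ}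
    (hT : ‖T‖ ≤ C) (F : LInftyProd K μ) : ‖density π T F‖ ≤ C * (‖F‖ * C) := by
  have hC : 0 ≤ C := (norm_nonneg _).trans hT
  have hTV := norm_comp_embedOne_le hT
  refine (ContinuousLinearMap.opNorm_comp_le _ _).trans (mul_le_mul ?_ ?_ (norm_nonneg _) hC)
  · rw [LinearIsometryEquiv.norm_map]
    exact hTV
  · exact (ContinuousLinearMap.opNorm_comp_le _ _).trans
      (mul_le_mul (norm_fiberOp_le π F) hTV (norm_nonneg _) (norm_nonneg _))

/-- `Ψ(F)` is the limit along `𝒰`, in the weak operator topology, of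
`∑_{t ∈ Ω} F(π t, ·) |w_nᵗ|²`. -/
def IsLimitMap (𝒰 : Ultrafilter ℕ) (π : Ω → K) (w : ℕ → RegHilbert Γ μ →L[ℂ] RegHilbert Γ μ)
    (Ψ : LInftyProd K μ → Lp ℂ ∞ μ) : Prop :=
  ∀ (F : LInftyProd K μ) (ξ η : Lp ℂ 2 μ),
    Tendsto (fun n => inner ℂ ξ (density π (w n) F η)) 𝒰 (𝓝 (inner ℂ ξ (mulOp (Ψ F) η)))

theorem eq_of_inner_mulOp_eq [SigmaFinite μ] {f g : Lp ℂ ∞ μ}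
    (h : ∀ ξ η : Lp ℂ 2 μ, (inner ℂ ξ (mulOp f η) : ℂ) = inner ℂ ξ (mulOp g η)) : f = g :=
  mulOp_injective (ContinuousLinearMap.ext fun η => ext_inner_left ℂ fun ξ => h ξ η)

theorem IsLimitMap.nonneg [SigmaFinite μ] {𝒰 : Ultrafilter ℕ} {π : Ω → K}
    {w : ℕ → RegHilbert Γ μ →L[ℂ] RegHilbert Γ μ} {Ψ : LInftyProd K μ → Lp ℂ ∞ μ}
    (hΨ : IsLimitMap 𝒰 π w Ψ) {F : LInftyProd K μ}
    (hF : ∀ k, ∀ᵐ x ∂μ, 0 ≤ F k x) : ∀ᵐ x ∂μ, 0 ≤ Ψ F x := by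
  refine nonneg_of_inner_mulOp_nonneg fun ξ => ge_of_tendsto (hΨ F ξ ξ) (.of_forall fun n => ?_)
  rw [inner_density]
  exact inner_fiberOp_nonneg π hF _

variable [MulAction Γ X] [NonsingularAction Γ μ]

theorem density_mulOp (π : Ω → K) {T : RegHilbert Γ μ →L[ℂ] RegHilbert Γ μ}
    (hT : T ∈ crossedProduct Γ μ) (F : LInftyProd K μ) (f : Lp ℂ ∞ μ) (ξ : Lp ℂ 2 μ) :
    density π T F (mulOp f ξ) = mulOp f (density π T F ξ) := by
  refine ext_inner_left ℂ fun η => ?_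
  rw [← inner_mulOp, inner_density, inner_density, embedOne_mulOp, embedOne_mulOp,
    crossedProduct_commute_diagConst hT, crossedProduct_commute_diagConst hT, fiberOp_diagConst,
    inner_diagConst]

theorem exists_isLimitMap [SigmaFinite μ] (𝒰 : Ultrafilter ℕ) (π : Ω → K)
    {w : ℕ → RegHilbert Γ μ →L[ℂ] RegHilbert Γ μ} (hw : ∀ n, w n ∈ crossedProduct Γ μ) {C : ℝ}
    (hC : ∀ n, ‖w n‖ ≤ C) :
    ∃ Ψ : LInftyProd K μ →ₗ[ℂ] Lp ℂ ∞ μ, IsLimitMap 𝒰 π w Ψ := by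
  have hex : ∀ F : LInftyProd K μ, ∃ ψ : Lp ℂ ∞ μ, ∀ ξ η : Lp ℂ 2 μ,
      Tendsto (fun n => inner ℂ ξ (density π (w n) F η)) 𝒰 (𝓝 (inner ℂ ξ (mulOp ψ η))) := by
    intro F
    obtain ⟨T, hT⟩ := exists_weak_limit 𝒰 (fun n => density π (w n) F)
      fun n => norm_density_le π (hC n) F
    obtain ⟨ψ, rfl⟩ := exists_eq_mulOp_of_commute T fun f ξ => by
      refine ext_inner_left ℂ fun η => ?_
      rw [← inner_mulOp]
      refine tendsto_nhds_unique (hT η (mulOp f ξ)) ?_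
      simpa only [density_mulOp π (hw _), ← inner_mulOp] using hT (mulOp (star f) η) ξ
    exact ⟨ψ, hT⟩
  choose Ψ hΨ using hex
  have hadd : ∀ T (F G : LInftyProd K μ) (ξ η : Lp ℂ 2 μ),
      (inner ℂ ξ (density π T (F + G) η) : ℂ) =
        inner ℂ ξ (density π T F η) + inner ℂ ξ (density π T G η) := by
    intro T F G ξ η
    rw [inner_density, inner_density, inner_density, fiberOp_add, add_apply, inner_add_right]
  have hsmul : ∀ T (c : ℂ) (F : LInftyProd K μ) (ξ η : Lp ℂ 2 μ),
      (inner ℂ ξ (density π T (c • F) η) : ℂ) = c * inner ℂ ξ (density π T F η) := by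
    intro T c F ξ η
    rw [inner_density, inner_density, fiberOp_smul, smul_apply, inner_smul_right]
  refine ⟨{ toFun := Ψ, map_add' := fun F G => ?_, map_smul' := fun c F => ?_ }, hΨ⟩
  · refine eq_of_inner_mulOp_eq fun ξ η => tendsto_nhds_unique (hΨ _ ξ η) ?_
    simp only [hadd]
    rw [mulOp_add, add_apply, inner_add_right]
    exact (hΨ F ξ η).add (hΨ G ξ η)
  · refine eq_of_inner_mulOp_eq fun ξ η => tendsto_nhds_unique (hΨ _ ξ η) ?_
    simp only [hsmul]
    rw [mulOp_smul, smul_apply, inner_smul_right]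
    exact (hΨ F ξ η).const_mul c

variable {𝒰 : Ultrafilter ℕ} {π : Ω → K} {w : ℕ → RegHilbert Γ μ →L[ℂ] RegHilbert Γ μ}
  {Ψ : LInftyProd K μ → Lp ℂ ∞ μ}

theorem IsLimitMap.map_oneTensor [SigmaFinite μ] (hΨ : IsLimitMap 𝒰 π w Ψ)
    (hw : ∀ n, w n ∈ crossedProduct Γ μ) (f : Lp ℂ ∞ μ) :
    Ψ (oneTensor K f) =ᵐ[μ] fun x => Ψ (oneTensor K (oneLp μ)) x * f x := by
  have h : mulOp (Ψ (oneTensor K f)) = mulOp (Ψ (oneTensor K (oneLp μ))) ∘L mulOp f := by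
    refine ContinuousLinearMap.ext fun η => ext_inner_left ℂ fun ξ => ?_
    refine tendsto_nhds_unique (hΨ _ ξ η) ?_
    simp only [inner_density, fiberOp_oneTensor π f, ← crossedProduct_commute_diagConst (hw _),
      ← embedOne_mulOp]
    simpa only [inner_density, ContinuousLinearMap.comp_apply] using hΨ (oneTensor K (oneLp μ)) ξ (mulOp f η)
  obtain ⟨v, hv0, -, hv⟩ := exists_pos_memLp_two μ
  have h' := congrArg (fun T => T (hv.toLp _)) h
  change mulOp _ _ = mulOp _ (mulOp _ _) at h'
  filter_upwards [coeFn_mulOp (Ψ (oneTensor K f)) (hv.toLp _), coeFn_mulOp f (hv.toLp _),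
    coeFn_mulOp (Ψ (oneTensor K (oneLp μ))) (mulOp f (hv.toLp _)), hv.coeFn_toLp]
    with x h1 h2 h3 h4
  rw [h', h3, h2, h4, ← mul_assoc] at h1
  have : (v x : ℂ) ≠ 0 := by exact_mod_cast (hv0 x).ne'
  exact (mul_right_cancel₀ this h1).symm

/-- Equivariance of `Ψ`: since `w_n` asymptotically commutes with `λ(s)`, the vectors
`w_n (δ_e ⊗ U_s ξ)` and `λ(s) R_s w_n (δ_e ⊗ ξ)` are asymptotically equal. -/
theorem IsLimitMap.equivariant [SigmaFinite μ] [MulAction Γ K]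
    (hΨ : IsLimitMap 𝒰 π w Ψ) (h𝒰 : (𝒰 : Filter ℕ) ≤ atTop)
    (hw : ∀ n, w n ∈ crossedProduct Γ μ) {C : ℝ} (hC : ∀ n, ‖w n‖ ≤ C)
    (hcent : ∀ s : Γ, UltrastrongTendsto
      (fun n => w n - leftReg μ s * w n * star (leftReg μ s)) 0)
    (hΩ : ∀ s t : Γ, t ∈ Ω → s * t * s⁻¹ ∈ Ω)
    (hπ : ∀ (s : Γ) (t : Ω), π ⟨s * t * s⁻¹, hΩ s t t.2⟩ = s • π t) (s : Γ)
    (F : LInftyProd K μ) : Ψ (diagTranslate s F) = translate s (Ψ F) := by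
  have hlim : ∀ ξ : Lp ℂ 2 μ, Tendsto (fun n => w n (embedOne Γ μ (koopman s ξ)) -
      leftReg μ s (rightReg s (w n (embedOne Γ μ ξ)))) 𝒰 (𝓝 0) := by
    intro ξ
    refine (((hcent s).tendsto_apply (embedOne Γ μ (koopman s ξ))).mono_left h𝒰).congr fun n => ?_
    rw [sub_apply, mul_apply_eq_comp, mul_apply_eq_comp, star_leftReg,
      crossedProduct_apply_leftReg_embedOne (hw n)]
  have hUb : ∀ (n : ℕ) (ξ : Lp ℂ 2 μ), ‖w n (embedOne Γ μ (koopman s ξ))‖ ≤ C * ‖ξ‖ := by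
    intro n ξ
    refine ((w n).le_of_opNorm_le (hC n) _).trans_eq ?_
    rw [norm_embedOne, LinearIsometry.norm_map]
  have hRb : ∀ (n : ℕ) (ξ : Lp ℂ 2 μ),
      ‖leftReg μ s (rightReg s (w n (embedOne Γ μ ξ)))‖ ≤ C * ‖ξ‖ := by
    intro n ξ
    rw [norm_leftReg_apply, ← crossedProduct_apply_leftReg_embedOne (hw n)]
    refine ((w n).le_of_opNorm_le (hC n) _).trans_eq ?_
    rw [norm_leftReg_apply, norm_embedOne, LinearIsometry.norm_map]
  have key : translate s⁻¹ (Ψ (diagTranslate s F)) = Ψ F := by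
    refine eq_of_inner_mulOp_eq fun ξ η => ?_
    -- The Koopman isometry turns `s⁻¹ · Ψ(s · F)` into `Ψ(s · F)`.
    have h1 : (inner ℂ ξ (mulOp (translate s⁻¹ (Ψ (diagTranslate s F))) η) : ℂ) =
        inner ℂ (koopman s ξ) (mulOp (Ψ (diagTranslate s F)) (koopman s η)) := by
      rw [← LinearIsometry.inner_map_map (koopman s), koopman_mulOp, translate_translate_inv]
    have h2 := tendsto_inner_sub_inner (fiberOp π (diagTranslate s F))
      (A := max (C * ‖ξ‖) (C * ‖η‖)) (fun n => (hUb n ξ).trans (le_max_left _ _))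
      (fun n => (hRb n η).trans (le_max_right _ _)) (hlim ξ) (hlim η)
    simp only [inner_fiberOp_diagTranslate hΩ hπ, ← inner_density] at h2
    rw [h1]
    exact sub_eq_zero.1 (tendsto_nhds_unique
      ((hΨ (diagTranslate s F) (koopman s ξ) (koopman s η)).sub (hΨ F ξ η)) h2)
  rw [← key, translate_translate_inv]

end LimitMap

/-! ### Amenable components -/

section Extend

variable {X : Type*} [MeasurableSpace X] {μ : Measure X} {E : Set X}

theorem ae_norm_indicator_le (hE : MeasurableSet E) (f : Lp ℂ ∞ (μ.restrict E)) :
    ∀ᵐ x ∂μ, ‖E.indicator f x‖ ≤ ‖f‖ := by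
  filter_upwards [(ae_restrict_iff' hE).1 (ae_norm_le_norm f)] with x hx
  by_cases h : x ∈ E
  · rw [Set.indicator_of_mem h]
    exact hx h
  · rw [Set.indicator_of_notMem h, norm_zero]
    exact norm_nonneg f

theorem memLp_extend (hE : MeasurableSet E) (f : Lp ℂ ∞ (μ.restrict E)) :
    MemLp (E.indicator f) ∞ μ :=
  memLp_top_of_bound ((Lp.stronglyMeasurable f).indicator hE).aestronglyMeasurable ‖f‖
    (ae_norm_indicator_le hE f)

/-- Extension by zero of functions in `L^∞(E)`. -/
noncomputable def extendLp (hE : MeasurableSet E) :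
    Lp ℂ ∞ (μ.restrict E) →ₗ[ℂ] Lp ℂ ∞ μ where
  toFun f := (memLp_extend hE f).toLp _
  map_add' f g := by
    apply Lp.ext
    filter_upwards [(memLp_extend hE (f + g)).coeFn_toLp, (memLp_extend hE f).coeFn_toLp,
      (memLp_extend hE g).coeFn_toLp, Lp.coeFn_add ((memLp_extend hE f).toLp _)
      ((memLp_extend hE g).toLp _), (ae_restrict_iff' hE).1 (Lp.coeFn_add f g)] with x h1 h2 h3 h4 h5
    rw [h1, h4, Pi.add_apply, h2, h3]
    by_cases h : x ∈ E
    · simp only [Set.indicator_of_mem h]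
      exact h5 h
    · simp only [Set.indicator_of_notMem h, add_zero]
  map_smul' c f := by
    apply Lp.ext
    filter_upwards [(memLp_extend hE (c • f)).coeFn_toLp, (memLp_extend hE f).coeFn_toLp,
      Lp.coeFn_smul c ((memLp_extend hE f).toLp _), (ae_restrict_iff' hE).1 (Lp.coeFn_smul c f)]
      with x h1 h2 h3 h4
    rw [h1, RingHom.id_apply, h3, Pi.smul_apply, h2]
    by_cases h : x ∈ E
    · simp only [Set.indicator_of_mem h]
      exact h4 h
    · simp only [Set.indicator_of_notMem h, smul_zero]

theorem coeFn_extendLp (hE : MeasurableSet E) (f : Lp ℂ ∞ (μ.restrict E)) :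
    extendLp hE f =ᵐ[μ] E.indicator f := (memLp_extend hE f).coeFn_toLp

theorem norm_extendLp_le (hE : MeasurableSet E) (f : Lp ℂ ∞ (μ.restrict E)) :
    ‖extendLp hE f‖ ≤ ‖f‖ := by
  refine ENNReal.toReal_le_of_le_ofReal (norm_nonneg f) ?_
  rw [eLpNorm_exponent_top]
  refine eLpNormEssSup_le_of_ae_bound ?_
  filter_upwards [coeFn_extendLp hE f, ae_norm_indicator_le hE f] with x h1 h2
  rwa [h1]

/-- Extension by zero of functions in `L^∞(K × E)`. -/
noncomputable def extendProd (K : Type*) (hE : MeasurableSet E) :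
    LInftyProd K (μ.restrict E) →ₗ[ℂ] LInftyProd K μ where
  toFun F := ⟨fun k => extendLp hE (F k), memℓp_infty ⟨‖F‖, by
    rintro _ ⟨k, rfl⟩
    exact (norm_extendLp_le hE _).trans (lp.norm_apply_le_norm ENNReal.top_ne_zero F _)⟩⟩
  map_add' F G := lp.ext (funext fun k => map_add (extendLp hE) (F k) (G k))
  map_smul' c F := lp.ext (funext fun k => map_smul (extendLp hE) c (F k))

theorem extendProd_apply {K : Type*} (hE : MeasurableSet E) (F : LInftyProd K (μ.restrict E))
    (k : K) : extendProd K hE F k = extendLp hE (F k) := rfl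

theorem extendProd_oneTensor {K : Type*} (hE : MeasurableSet E) (f : Lp ℂ ∞ (μ.restrict E)) :
    extendProd K hE (oneTensor K f) = oneTensor K (extendLp hE f) := rfl

variable {u : X → ℂ} {C : ℝ}

theorem memLp_mulRestrict (hE : MeasurableSet E) (hu : Measurable u) (hC : ∀ x ∈ E, ‖u x‖ ≤ C)
    (g : Lp ℂ ∞ μ) : MemLp (fun x => u x * g x) ∞ (μ.restrict E) := by
  refine memLp_top_of_bound
    (hu.mul (Lp.stronglyMeasurable g).measurable).aestronglyMeasurable (C * ‖g‖) ?_
  filter_upwards [ae_restrict_of_ae (ae_norm_le_norm g), ae_restrict_mem hE] with x h1 h2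
  rw [norm_mul]
  exact mul_le_mul (hC x h2) h1 (norm_nonneg _) ((norm_nonneg _).trans (hC x h2))

/-- The map `g ↦ (u g)|_E` from `L^∞(X)` to `L^∞(E)`, for a function `u` that is bounded on
`E`. -/
noncomputable def mulRestrict (hE : MeasurableSet E) (hu : Measurable u)
    (hC : ∀ x ∈ E, ‖u x‖ ≤ C) : Lp ℂ ∞ μ →ₗ[ℂ] Lp ℂ ∞ (μ.restrict E) where
  toFun g := (memLp_mulRestrict hE hu hC g).toLp _
  map_add' f g := by
    apply Lp.ext
    filter_upwards [(memLp_mulRestrict hE hu hC (f + g)).coeFn_toLp,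
      (memLp_mulRestrict hE hu hC f).coeFn_toLp, (memLp_mulRestrict hE hu hC g).coeFn_toLp,
      Lp.coeFn_add ((memLp_mulRestrict hE hu hC f).toLp _) ((memLp_mulRestrict hE hu hC g).toLp _),
      ae_restrict_of_ae (Lp.coeFn_add f g)] with x h1 h2 h3 h4 h5
    rw [h1, h4, Pi.add_apply, h2, h3, h5, Pi.add_apply, mul_add]
  map_smul' c f := by
    apply Lp.ext
    filter_upwards [(memLp_mulRestrict hE hu hC (c • f)).coeFn_toLp,
      (memLp_mulRestrict hE hu hC f).coeFn_toLp,
      Lp.coeFn_smul c ((memLp_mulRestrict hE hu hC f).toLp _),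
      ae_restrict_of_ae (Lp.coeFn_smul c f)] with x h1 h2 h3 h4
    rw [h1, RingHom.id_apply, h3, Pi.smul_apply, h2, h4, Pi.smul_apply, smul_eq_mul, smul_eq_mul,
      mul_left_comm]

theorem coeFn_mulRestrict (hE : MeasurableSet E) (hu : Measurable u) (hC : ∀ x ∈ E, ‖u x‖ ≤ C)
    (g : Lp ℂ ∞ μ) : mulRestrict hE hu hC g =ᵐ[μ.restrict E] fun x => u x * g x :=
  (memLp_mulRestrict hE hu hC g).coeFn_toLp

end Extend

section Component

variable {Γ : Type*} [Group Γ] {X : Type*} [MeasurableSpace X] [MulAction Γ X]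
  {μ : Measure X} [NonsingularAction Γ μ]

theorem extendLp_translate {E : Set X} (hEm : MeasurableSet E)
    (hE : ∀ (s : Γ) (x : X), s • x ∈ E ↔ x ∈ E) [NonsingularAction Γ (μ.restrict E)] (s : Γ)
    (f : Lp ℂ ∞ (μ.restrict E)) :
    extendLp hEm (translate s f) = translate s (extendLp hEm f) := by
  apply Lp.ext
  filter_upwards [coeFn_extendLp hEm (translate s f), coeFn_translate s (extendLp hEm f),
    ae_smul s⁻¹ (coeFn_extendLp hEm f), (ae_restrict_iff' hEm).1 (coeFn_translate s f)]
    with x h1 h2 h3 h4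
  rw [h1, h2, h3]
  by_cases h : x ∈ E
  · rw [Set.indicator_of_mem h, Set.indicator_of_mem ((hE s⁻¹ x).2 h), h4 h]
  · rw [Set.indicator_of_notMem h, Set.indicator_of_notMem (mt (hE s⁻¹ x).1 h)]

theorem translate_oneLp (s : Γ) : translate s (oneLp μ) = oneLp μ := by
  apply Lp.ext
  filter_upwards [coeFn_translate s (oneLp μ), coeFn_oneLp (μ := μ),
    ae_smul s⁻¹ (coeFn_oneLp (μ := μ))] with x h1 h2 h3
  rw [h1, h2, h3]

/-- The largest invariant subset of `{x | ε < h x}` for an almost invariant function `h`. -/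
theorem exists_invariant_set [Countable Γ] {h : X → ℝ} (hm : Measurable h)
    (hinv : ∀ s : Γ, ∀ᵐ x ∂μ, h (s • x) = h x) {ε : ℝ} (hε : μ {x | ε < h x} ≠ 0) :
    ∃ E : Set X, MeasurableSet E ∧ (∀ (s : Γ) (x : X), s • x ∈ E ↔ x ∈ E) ∧ μ E ≠ 0 ∧
      ∀ x ∈ E, ε < h x := by
  refine ⟨{x | ∀ s : Γ, ε < h (s • x)}, ?_, fun s x => ⟨fun hx r => ?_, fun hx r => ?_⟩, ?_,
    fun x hx => by simpa using hx 1⟩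
  · rw [Set.ofPred_forall]
    exact MeasurableSet.iInter fun s => measurableSet_lt measurable_const
      (hm.comp (NonsingularAction.quasiMeasurePreserving (μ := μ) s).measurable)
  · simpa [smul_smul] using hx (r * s⁻¹)
  · rw [smul_smul]
    exact hx (r * s)
  -- As `Γ` is countable, almost every orbit meets `{x | ε < h x}` either fully or not at all.
  · refine fun h0 => hε (measure_mono_null_ae ?_ h0)
    filter_upwards [ae_all_iff.2 hinv] with x hx hxε s
    rw [hx s]
    exact hxε

/-- A positive equivariant linear map `Ψ : L^∞(K × X) → L^∞(X)` with `Ψ(1 ⊗ f) = h f` and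
`h ≠ 0` yields an amenable component: on an invariant set where `h` is bounded away from zero, the
map `h⁻¹ Ψ` is an equivariant conditional expectation. -/
theorem hasAmenableComponent_of_positive_map [Countable Γ] {𝒞 : Set (Subgroup Γ)}
    (Ψ : LInftyProd (CosetUnion 𝒞) μ →ₗ[ℂ] Lp ℂ ∞ μ)
    (hpos : ∀ F, (∀ k, ∀ᵐ x ∂μ, 0 ≤ F k x) → ∀ᵐ x ∂μ, 0 ≤ Ψ F x)
    (hone : ∀ f : Lp ℂ ∞ μ, Ψ (oneTensor _ f) =ᵐ[μ] fun x => Ψ (oneTensor _ (oneLp μ)) x * f x)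
    (hequiv : ∀ (s : Γ) F, Ψ (diagTranslate s F) = translate s (Ψ F))
    (hne : Ψ (oneTensor _ (oneLp μ)) ≠ 0) : HasAmenableComponent 𝒞 μ := by
  set h : Lp ℂ ∞ μ := Ψ (oneTensor _ (oneLp μ)) with hh
  have hm : Measurable h := (Lp.stronglyMeasurable h).measurable
  have hh0 : ∀ᵐ x ∂μ, 0 ≤ h x := hpos _ fun k => by
    filter_upwards [coeFn_oneLp (μ := μ)] with x hx
    change 0 ≤ oneLp μ x
    rw [hx]
    exact zero_le_one
  have hinv' : ∀ s : Γ, translate s h = h := fun s => by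
    rw [hh, ← hequiv]
    congr 1
    exact lp.ext (funext fun k => translate_oneLp s)
  have hinv : ∀ s : Γ, ∀ᵐ x ∂μ, h (s • x) = h x := fun s => by
    have := coeFn_translate s⁻¹ h
    rw [hinv', inv_inv] at this
    exact this.mono fun x hx => hx.symm
  obtain ⟨ε, hε0, hε⟩ : ∃ ε : ℝ, 0 < ε ∧ μ {x | ε < (h x).re} ≠ 0 := by
    -- Otherwise `h ≤ 1 / (n + 1)` almost everywhere for every `n`, so that `h = 0`.
    by_contra! hcon
    refine hne (Lp.eq_zero_iff_ae_eq_zero.2 ?_)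
    have hsmall : ∀ᵐ x ∂μ, ∀ n : ℕ, (h x).re ≤ 1 / ((n : ℝ) + 1) := by
      refine ae_all_iff.2 fun n => ?_
      have := hcon (1 / ((n : ℝ) + 1)) (by positivity)
      exact (ae_iff.2 (by simpa using this))
    filter_upwards [hsmall, hh0] with x h1 h2
    have h3 : (h x).re ≤ 0 := ge_of_tendsto' tendsto_one_div_add_atTop_nhds_zero_nat h1
    exact Complex.ext (le_antisymm h3 (Complex.nonneg_iff.1 h2).1) (Complex.nonneg_iff.1 h2).2.symm
  obtain ⟨E, hEm, hE, hE0, hEε⟩ := exists_invariant_set (μ := μ) (h := fun x => (h x).re)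
    (Complex.measurable_re.comp hm) (fun s => (hinv s).mono fun x hx => by rw [hx]) hε
  have hu : Measurable fun x => (h x)⁻¹ := hm.inv
  have hne' : ∀ x ∈ E, h x ≠ 0 := fun x hx h0 => by
    have := hEε x hx
    simp only [h0, Complex.zero_re] at this
    exact this.not_gt hε0
  have hC : ∀ x ∈ E, ‖(h x)⁻¹‖ ≤ ε⁻¹ := fun x hx => by
    rw [norm_inv]
    exact inv_anti₀ hε0 ((hEε x hx).le.trans (Complex.re_le_norm _))
  let Φ := mulRestrict hEm hu hC ∘ₗ Ψ ∘ₗ extendProd (μ := μ) (CosetUnion 𝒞) hEm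
  have hΦ : ∀ F, Φ F =ᵐ[μ.restrict E] fun x => (h x)⁻¹ * Ψ (extendProd _ hEm F) x := fun F =>
    coeFn_mulRestrict hEm hu hC _
  have := NonsingularAction.restrict μ hE
  refine ⟨E, hE, hEm, hE0, Φ, fun F hF => ?_, fun f => Lp.ext ?_, fun s F => Lp.ext ?_⟩
  · have hF' := hpos (extendProd _ hEm F) fun k => by
      rw [extendProd_apply]
      filter_upwards [coeFn_extendLp hEm (F k), (ae_restrict_iff' hEm).1 (hF k)] with x h1 h2
      rw [h1]
      by_cases hx : x ∈ E
      · rw [Set.indicator_of_mem hx]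
        exact h2 hx
      · rw [Set.indicator_of_notMem hx]
    filter_upwards [hΦ F, ae_restrict_of_ae hF', ae_restrict_of_ae hh0] with x h1 h2 h3
    rw [h1]
    exact mul_nonneg (inv_nonneg.2 h3) h2
  · filter_upwards [hΦ (oneTensor _ f), ae_restrict_of_ae (hone (extendLp hEm f)),
      ae_restrict_mem hEm, ae_restrict_of_ae (coeFn_extendLp hEm f)] with x h1 h2 h3 h4
    rw [h1, extendProd_oneTensor, h2, h4, Set.indicator_of_mem h3, inv_mul_cancel_left₀ (hne' x h3)]
  · have hext : extendProd _ hEm (diagTranslate s F) = diagTranslate s (extendProd _ hEm F) :=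
      lp.ext (funext fun k => extendLp_translate hEm hE s _)
    filter_upwards [hΦ (diagTranslate s F), coeFn_translate s (Φ F), ae_smul s⁻¹ (hΦ F),
      ae_restrict_of_ae (coeFn_translate s (Ψ (extendProd _ hEm F))),
      ae_restrict_of_ae (hinv s⁻¹)] with x h1 h2 h3 h4 h5
    rw [h1, h2, h3, hext, hequiv, h4, h5]

end Component

/-! ### The densities as pointwise sums -/

section Density

/-- A series of nonnegative integrable functions that converges to `g` after integration over
every measurable set converges to `g` almost everywhere. -/
theorem ae_hasSum_of_hasSum_setIntegral {X ι : Type*} [Countable ι] [MeasurableSpace X]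
    {μ : Measure X} [SigmaFinite μ] {f : ι → X → ℝ} {g : X → ℝ} (hf : ∀ i, Integrable (f i) μ)
    (hf0 : ∀ i x, 0 ≤ f i x) (hg : Integrable g μ) (hg0 : 0 ≤ᵐ[μ] g)
    (hsum : ∀ A, MeasurableSet A → HasSum (fun i => ∫ x in A, f i x ∂μ) (∫ x in A, g x ∂μ)) :
    ∀ᵐ x ∂μ, HasSum (fun i => f i x) (g x) := by
  have hfm : ∀ i, AEMeasurable (fun x => ENNReal.ofReal (f i x)) μ := fun i =>
    (hf i).aemeasurable.ennreal_ofReal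
  have h : (fun x => ∑' i, ENNReal.ofReal (f i x)) =ᵐ[μ] fun x => ENNReal.ofReal (g x) := by
    refine ae_eq_of_forall_setLIntegral_eq_of_sigmaFinite₀ (AEMeasurable.tsum hfm)
      hg.aemeasurable.ennreal_ofReal fun A hA _ => ?_
    rw [lintegral_tsum fun i => (hfm i).restrict, ← ofReal_integral_eq_lintegral_ofReal
      hg.integrableOn (ae_restrict_of_ae hg0), ← (hsum A hA).tsum_eq,
      ENNReal.ofReal_tsum_of_nonneg (fun i => integral_nonneg (hf0 i)) (hsum A hA).summable]
    exact tsum_congr fun i => (ofReal_integral_eq_lintegral_ofReal (hf i).integrableOn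
      (.of_forall (hf0 i))).symm
  filter_upwards [h, hg0] with x hx hx0
  have hne : ∑' i, ENNReal.ofReal (f i x) ≠ ∞ := by rw [hx]; exact ENNReal.ofReal_ne_top
  have h1 := ENNReal.hasSum_toReal hne
  rw [← ENNReal.tsum_toReal_eq fun i => ENNReal.ofReal_ne_top, hx, ENNReal.toReal_ofReal hx0] at h1
  simpa only [ENNReal.toReal_ofReal (hf0 _ x)] using h1

variable {Γ : Type*} [Group Γ] {X : Type*} [MeasurableSpace X] {μ : Measure X} {K : Type*}
  {Ω : Set Γ}

/-- The density `A = V* T* P T V`, where `P` is a projection, satisfies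
`‖A ξ‖² ≤ ‖T‖² ⟨ξ, A ξ⟩`. -/
theorem norm_density_one_apply_sq_le (π : Ω → K) {T : RegHilbert Γ μ →L[ℂ] RegHilbert Γ μ} {C : ℝ}
    (hT : ‖T‖ ≤ C) (ξ : Lp ℂ 2 μ) :
    ‖density π T (oneTensor K (oneLp μ)) ξ‖ ^ 2 ≤
      C ^ 2 * ‖(inner ℂ ξ (density π T (oneTensor K (oneLp μ)) ξ) : ℂ)‖ := by
  rw [inner_density, inner_fiberOp_one, Complex.norm_real, Real.norm_of_nonneg (sq_nonneg _),
    ← mul_pow]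
  refine pow_le_pow_left₀ (norm_nonneg _) ?_ 2
  refine (ContinuousLinearMap.adjoint (T ∘L embedOne Γ μ)).le_of_opNorm_le ?_
    (fiberOp π (oneTensor K (oneLp μ)) (T (embedOne Γ μ ξ)))
  rw [LinearIsometryEquiv.norm_map]
  exact norm_comp_embedOne_le hT

variable [MulAction Γ X] [NonsingularAction Γ μ]

theorem exists_density_eq_mulOp [SigmaFinite μ] (π : Ω → K)
    {T : RegHilbert Γ μ →L[ℂ] RegHilbert Γ μ} (hT : T ∈ crossedProduct Γ μ)
    (F : LInftyProd K μ) : ∃ h : Lp ℂ ∞ μ, density π T F = mulOp h :=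
  exists_eq_mulOp_of_commute _ fun f ξ => density_mulOp π hT F f ξ

/-- The quadratic form of the density is the sum of the quadratic forms of `|wᵗ|²`, `t ∈ Ω`. -/
theorem hasSum_norm_mulOp_coeff_sq [SigmaFinite μ] (π : Ω → K) (w : crossedProduct Γ μ)
    (ξ : Lp ℂ 2 μ) :
    HasSum (fun t : Ω => ((‖mulOp (coeff w (t : Γ)) ξ‖ ^ 2 : ℝ) : ℂ))
      (inner ℂ ξ (density π (w : RegHilbert Γ μ →L[ℂ] RegHilbert Γ μ)
        (oneTensor K (oneLp μ)) ξ)) := by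
  rw [inner_density]
  have h := lp.hasSum_inner (𝕜 := ℂ)
    ((w : RegHilbert Γ μ →L[ℂ] RegHilbert Γ μ) (embedOne Γ μ ξ))
    (fiberOp π (oneTensor K (oneLp μ)) ((w : RegHilbert Γ μ →L[ℂ] RegHilbert Γ μ)
      (embedOne Γ μ ξ)))
  rw [← hasSum_subtype_iff_of_support_subset (s := Ω)] at h
  · refine Eq.mpr (congrArg (fun f => HasSum f _) (funext fun t => ?_)) h
    rw [Function.comp_apply, fiberOp_apply, mulOp_pullback_one_of_mem π t.2, mulOp_coeff_apply,
      Complex.ofReal_pow]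
    exact (inner_self_eq_norm_sq_to_K (𝕜 := ℂ)
      ((w : RegHilbert Γ μ →L[ℂ] RegHilbert Γ μ) (embedOne Γ μ ξ) t)).symm
  · refine Function.support_subset_iff'.2 fun t ht => ?_
    rw [fiberOp_apply, mulOp_pullback_one_of_notMem π ht, inner_zero_right]

/-- The density is the pointwise sum of the functions `|wᵗ|²`, `t ∈ Ω`: testing the quadratic forms
on the vectors `1_A v`, with `v` strictly positive, shows that the integrals over all measurable
sets `A` agree. -/
theorem ae_hasSum_norm_coeff_sq [SigmaFinite μ] [Countable Γ] (π : Ω → K)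
    (w : crossedProduct Γ μ) {h : Lp ℂ ∞ μ}
    (hh : density π (w : RegHilbert Γ μ →L[ℂ] RegHilbert Γ μ) (oneTensor K (oneLp μ)) = mulOp h) :
    ∀ᵐ x ∂μ, HasSum (fun t : Ω => ((‖coeff w (t : Γ) x‖ ^ 2 : ℝ) : ℂ)) (h x) := by
  obtain ⟨v, hv0, -, hv⟩ := exists_pos_memLp_two μ
  have hh0 : ∀ᵐ x ∂μ, 0 ≤ h x := by
    refine nonneg_of_inner_mulOp_nonneg fun ξ => ?_
    rw [← hh, inner_density, inner_fiberOp_one]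
    exact Complex.zero_le_real.2 (sq_nonneg _)
  have hi := integrable_mul_sq h hv
  have hcx : ∀ t : Ω, (mulOp (coeff w (t : Γ)) (hv.toLp _)) =ᵐ[μ]
      fun x => coeff w (t : Γ) x * (v x : ℂ) := fun t => by
    filter_upwards [coeFn_mulOp (coeff w (t : Γ)) (hv.toLp _), hv.coeFn_toLp] with x h1 h2
    rw [h1, h2]
  have hci : ∀ t : Ω, Integrable (fun x => ‖coeff w (t : Γ) x‖ ^ 2 * v x ^ 2) μ := fun t => by
    have := (memLp_two_iff_integrable_sq_norm (Lp.aestronglyMeasurable _)).1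
      (Lp.memLp (mulOp (coeff w (t : Γ)) (hv.toLp _)))
    refine this.congr ?_
    filter_upwards [hcx t] with x hx
    rw [hx, norm_mul, mul_pow, Complex.norm_real, Real.norm_of_nonneg (hv0 x).le]
  have key := ae_hasSum_of_hasSum_setIntegral (μ := μ) hci (fun t x => by positivity) hi.re
    (by
      filter_upwards [hh0] with x hx
      have : (0 : ℂ) ≤ h x * (v x : ℂ) ^ 2 := by
        rw [← Complex.ofReal_pow]
        exact mul_nonneg hx (Complex.zero_le_real.2 (sq_nonneg _))
      exact (Complex.nonneg_iff.1 this).1)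
    fun A hA => by
      have hs := hasSum_norm_mulOp_coeff_sq π w ((hv.indicator hA).toLp _)
      rw [hh, inner_mulOp_indicator h hv hA] at hs
      have hs' := Complex.hasSum_re hs
      convert hs' using 2 with t
      · rw [Complex.ofReal_re, norm_sq_eq_integral, ← integral_indicator hA]
        apply integral_congr_ae
        filter_upwards [coeFn_mulOp (coeff w (t : Γ)) ((hv.indicator hA).toLp _),
          (hv.indicator hA).coeFn_toLp] with x h1 h2
        rw [h1, h2]
        by_cases hx : x ∈ A
        · rw [Set.indicator_of_mem hx, Set.indicator_of_mem hx, norm_mul, mul_pow,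
            Complex.norm_real, Real.norm_of_nonneg (hv0 x).le]
        · rw [Set.indicator_of_notMem hx, Set.indicator_of_notMem hx]
          simp
      · exact integral_re hi.integrableOn
  filter_upwards [key, hh0] with x hx hx0
  have hvx : (v x : ℂ) ^ 2 ≠ 0 := pow_ne_zero 2 (by exact_mod_cast (hv0 x).ne')
  have hre : h x = ((h x).re : ℂ) :=
    Complex.ext rfl (by simpa using (Complex.nonneg_iff.1 hx0).2.symm)
  rw [RCLike.re_to_complex, ← Complex.ofReal_pow, Complex.re_mul_ofReal] at hx
  have hx' := (Complex.hasSum_ofReal.2 hx).mul_right (((v x : ℂ) ^ 2)⁻¹)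
  push_cast at hx' ⊢
  simp only [mul_inv_cancel_right₀ hvx] at hx'
  rwa [hre]

end Density

end CrossedProd

theorem mainTheorem1 {Γ : Type*} [Group Γ] [Countable Γ]
    {X : Type*} [MeasurableSpace X] [StandardBorelSpace X] [MulAction Γ X]
    (μ : Measure X) [SigmaFinite μ] [NonsingularAction Γ μ]
    (Ω : Set Γ) (hΩ : ∀ s t : Γ, t ∈ Ω → s * t * s⁻¹ ∈ Ω)
    (hX : ¬ HasAmenableComponent
      {Λ : Subgroup Γ | ∃ t ∈ Ω, Λ = Subgroup.centralizer ({t} : Set Γ)} μ)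
    (w : ℕ → crossedProduct Γ μ)
    (hbdd : ∃ C : ℝ, ∀ n, ‖(w n : RegHilbert Γ μ →L[ℂ] RegHilbert Γ μ)‖ ≤ C)
    (hcent : ∀ s : Γ, UltrastrongTendsto
      (fun n => (w n : RegHilbert Γ μ →L[ℂ] RegHilbert Γ μ) -
        leftReg μ s * (w n : RegHilbert Γ μ →L[ℂ] RegHilbert Γ μ) * star (leftReg μ s)) 0) :
    ∃ h : ℕ → Lp ℂ ∞ μ,
      (∀ n, ∀ᵐ x ∂μ,
        HasSum (fun t : Ω => ((‖coeff (w n) (t : Γ) x‖ ^ 2 : ℝ) : ℂ)) (h n x)) ∧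
      UltrastrongTendsto (fun n => mulOp (h n)) 0 := by
  obtain ⟨C, hC⟩ := hbdd
  obtain ⟨π, hπ⟩ := exists_equivariant_map_cosetUnion Ω hΩ
  choose h hh using fun n => exists_density_eq_mulOp π (w n).2 (oneTensor _ (oneLp μ))
  refine ⟨h, fun n => ae_hasSum_norm_coeff_sq π (w n) (hh n), fun ξ hξ => ?_⟩
  -- Convergence is tested along ultrafilters, which avoids the choice of subsequences.
  rw [tendsto_iff_ultrafilter]
  intro 𝒰 h𝒰
  obtain ⟨Ψ, hΨ⟩ := exists_isLimitMap 𝒰 π (fun n => (w n).2) hC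
  have h0 : Ψ (oneTensor _ (oneLp μ)) = 0 := by
    by_contra hne
    exact hX (hasAmenableComponent_of_positive_map Ψ (fun F hF => hΨ.nonneg hF)
      (hΨ.map_oneTensor fun n => (w n).2)
      (hΨ.equivariant h𝒰 (fun n => (w n).2) hC hcent hΩ hπ) hne)
  have hweak : ∀ k, Tendsto (fun n => ‖mulOp (h n) (ξ k)‖ ^ 2) 𝒰 (𝓝 0) := by
    intro k
    have h1 := (hΨ (oneTensor _ (oneLp μ)) (ξ k) (ξ k)).norm.const_mul (C ^ 2)
    rw [h0, mulOp_zero, zero_apply, inner_zero_right, norm_zero, mul_zero] at h1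
    refine squeeze_zero (fun n => sq_nonneg _) (fun n => ?_) h1
    rw [← hh]
    exact norm_density_one_apply_sq_le π (hC n) (ξ k)
  have hdom := tendsto_tsum_of_dominated_convergence (𝓕 := (𝒰 : Filter ℕ))
    (hξ.mul_left ((C * (‖oneTensor (CrossedProd.CosetUnion _) (oneLp μ)‖ * C)) ^ 2)) hweak
    (.of_forall fun n k => by
      rw [Real.norm_of_nonneg (sq_nonneg _), ← mul_pow, ← hh]
      exact pow_le_pow_left₀ (norm_nonneg _)
        (ContinuousLinearMap.le_of_opNorm_le _ (norm_density_le π (hC n) _) _) 2)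
  simpa only [sub_zero, tsum_zero] using hdom
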